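/- Let $K$ be a fixed number of classes, $\mu$ a probability measure on $\mathbb R$ with compact support contained in $(0,1)$, and $c=(c_1,\dots,c_K)^{\mathsf T}$ with all $c_k>0$. For each $n$ let $g=g^{(n)}:\{1,\dots,n\}\to\{1,\dots,K\}$ be a deterministic class assignment whose class sizes $n_k=|\{i: g_i=k\}|$ satisfy $n_k/n\to c_k$ as $n\to\infty$, and let $M=M^{(n)}\in\mathbb R^{K\times K}$ be deterministic symmetric matrices whose entries are $O(1)$ as $n\to\infty$. Put $C_{ab}=1+M_{ab}/\sqrt n$. On a common probability space let, for each (sufficiently large) $n$, $q=(q_1,\dots,q_n)^{\mathsf T}$ have i.i.d. entries of law $\mu$ and let $A\in\{0,1\}^{n\times n}$ be the (symmetric, zero-diagonal) adjacency matrix of a random graph on $n$ nodes such that, conditionally on $q$, the entries $A_{ij}$, $i<j$, are independent Bernoulli variables with parameters $P_{ij}=q_iq_jC_{g_ig_j}\in(0,1)$ (degree-corrected stochastic block model); no assumption is made on the dependence between different values of $n$. Write $1_n$ for the all-ones vector, $d=A1_n$, $D=\mathrm{diag}(d)$, $2m=d^{\mathsf T}1_n$, $D_q=\mathrm{diag}(q)$,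 $J\in\{0,1\}^{n\times K}$ with $J_{ia}=1$ if and only if $g_i=a$, and $X_{ij}=A_{ij}-q_iq_j-q_iq_jM_{g_ig_j}/\sqrt n$ for $1\le i,j\le n$. For $\alpha\in\mathbb R$ let $$L_\alpha=(2m)^\alpha\frac1{\sqrt n}D^{-\alpha}\Big[A-\frac{dd^{\mathsf T}}{2m}\Big]D^{-\alpha},\qquad \tilde L_\alpha=\frac1{\sqrt n}D_q^{-\alpha}XD_q^{-\alpha}+U\Lambda U^{\mathsf T},$$ $$U=\begin{bmatrix}\dfrac{D_q^{1-\alpha}J}{\sqrt n} & \dfrac{D_q^{-\alpha}X1_n}{q^{\mathsf T}1_n}\end{bmatrix}\in\mathbb R^{n\times(K+1)},\qquad \Lambda=\begin{bmatrix}(I_K-1_Kc^{\mathsf T})M(I_K-c1_K^{\mathsf T}) & -1_K\\ -1_K^{\mathsf T} & 0\end{bmatrix}.$$ Theorem. For every $\alpha\in\mathbb R$, almost surely, all degrees $d_i$ are positive for all sufficiently large $n$ (so that $L_\alpha$ is well defined), and $\|L_\alpha-\tilde L_\alpha\|\to0$ as $n\to\infty$, where $\|\cdot\|$ is the operator norm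 on Euclidean space. -/

import Mathlib

open MeasureTheory ProbabilityTheory Filter Topology Matrix

noncomputable section

namespace DCSBM

/-- Connection probability `q i * q j * C (g i) (g j)`. -/
def edgeProb {n K : ℕ} (g : Fin n → Fin K) (C : Matrix (Fin K) (Fin K) ℝ) (q : Fin n → ℝ)
    (i j : Fin n) : ℝ :=
  q i * q j * C (g i) (g j)

open Classical in
/-- Probability that the graph `H` is drawn when the edges `{i, j}`, `i < j`, are independent
Bernoulli variables with parameters `edgeProb g C q i j`. -/
def graphProb {n K : ℕ} (g : Fin n → Fin K) (C : Matrix (Fin K) (Fin K) ℝ) (q : Fin n → ℝ)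
    (H : SimpleGraph (Fin n)) : ℝ :=
  ∏ i, ∏ j ∈ Finset.Ioi i, if H.Adj i j then edgeProb g C q i j else 1 - edgeProb g C q i j

/-- `G` is a random graph on `n` nodes drawn from the degree-corrected stochastic block model with
group assignment `g`, class weights `C` and intrinsic weights `q` that are i.i.d. of law `μ`:
given `q`, the edges `{i, j}` are independent Bernoulli with parameter `q i * q j * C (g i) (g j)`,
which lies in `(0, 1)`. -/
structure IsDCSBM {Ω : Type*} [MeasurableSpace Ω] (P : Measure Ω) (μ : Measure ℝ) {n K : ℕ}
    (g : Fin n → Fin K) (C : Matrix (Fin K) (Fin K) ℝ)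
    (q : Fin n → Ω → ℝ) (G : Ω → SimpleGraph (Fin n)) : Prop where
  symm : C.IsSymm
  measurable_weight : ∀ i, Measurable (q i)
  law_weight : ∀ i, P.map (q i) = μ
  indep_weight : iIndepFun q P
  prob_mem : ∀ᵐ ω ∂P, ∀ i j, i ≠ j → edgeProb g C (fun k => q k ω) i j ∈ Set.Ioo (0 : ℝ) 1
  measurable_graph : ∀ H, MeasurableSet {ω | G ω = H}
  cond_law : ∀ H,
    P[({ω | G ω = H}).indicator (fun _ => (1 : ℝ)) |
        MeasurableSpace.comap (fun ω i => q i ω) MeasurableSpace.pi]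
      =ᵐ[P] fun ω => graphProb g C (fun k => q k ω) H

/-- Class weights `C a b = 1 + M a b / √n`. -/
def classWeights (n : ℕ) {K : ℕ} (M : Matrix (Fin K) (Fin K) ℝ) : Matrix (Fin K) (Fin K) ℝ :=
  Matrix.of fun a b => 1 + M a b / √(n : ℝ)

open Classical in
/-- Adjacency matrix of a graph. -/
def adjacency {n : ℕ} (G : SimpleGraph (Fin n)) : Matrix (Fin n) (Fin n) ℝ :=
  G.adjMatrix ℝ

/-- Diagonal matrix whose entries are the `s`-th powers of those of `v`. -/
def diagPow {n : ℕ} (v : Fin n → ℝ) (s : ℝ) : Matrix (Fin n) (Fin n) ℝ :=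
  Matrix.diagonal fun i => v i ^ s

/-- The `α`-normalized modularity matrix
`(2m)^α n^{-1/2} D^{-α} (A - d dᵀ / (2m)) D^{-α}`, where `d = A 1` and `2m = dᵀ 1`. -/
def modularity {n : ℕ} (α : ℝ) (A : Matrix (Fin n) (Fin n) ℝ) : Matrix (Fin n) (Fin n) ℝ :=
  let d : Fin n → ℝ := A *ᵥ 1
  let twoM : ℝ := d ⬝ᵥ 1
  (twoM ^ α * (√(n : ℝ))⁻¹) •
    (diagPow d (-α) * (A - twoM⁻¹ • Matrix.vecMulVec d d) * diagPow d (-α))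

/-- The noise matrix `X i j = A i j - q i q j - q i q j M (g i) (g j) / √n`. -/
def noise {n K : ℕ} (g : Fin n → Fin K) (M : Matrix (Fin K) (Fin K) ℝ) (q : Fin n → ℝ)
    (A : Matrix (Fin n) (Fin n) ℝ) : Matrix (Fin n) (Fin n) ℝ :=
  Matrix.of fun i j => A i j - q i * q j - q i * q j * (M (g i) (g j) / √(n : ℝ))

/-- The class indicator matrix `J i a = 1` if `g i = a`, else `0`. -/
def classIndicator {n K : ℕ} (g : Fin n → Fin K) : Matrix (Fin n) (Fin K) ℝ :=
  Matrix.of fun i a => if g i = a then 1 else 0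

/-- `U = [ D_q^{1-α} J / √n | D_q^{-α} X 1 / (qᵀ 1) ]`, of size `n × (K + 1)`. -/
def spikeU {n K : ℕ} (α : ℝ) (g : Fin n → Fin K) (q : Fin n → ℝ)
    (X : Matrix (Fin n) (Fin n) ℝ) : Matrix (Fin n) (Fin K ⊕ Unit) ℝ :=
  Matrix.fromCols
    ((√(n : ℝ))⁻¹ • (diagPow q (1 - α) * classIndicator g))
    (Matrix.replicateCol Unit ((q ⬝ᵥ 1)⁻¹ • ((diagPow q (-α) * X) *ᵥ 1)))

/-- `Λ = [ (I - 1 cᵀ) M (I - c 1ᵀ), -1 ; -1ᵀ, 0 ]`, of size `(K + 1) × (K + 1)`. -/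
def spikeΛ {K : ℕ} (M : Matrix (Fin K) (Fin K) ℝ) (c : Fin K → ℝ) :
    Matrix (Fin K ⊕ Unit) (Fin K ⊕ Unit) ℝ :=
  Matrix.fromBlocks
    ((1 - Matrix.vecMulVec 1 c) * M * (1 - Matrix.vecMulVec c 1))
    (-Matrix.replicateCol Unit 1)
    (-Matrix.replicateRow Unit 1)
    0

/-- The spiked approximation `n^{-1/2} D_q^{-α} X D_q^{-α} + U Λ Uᵀ`. -/
def spikedModel {n K : ℕ} (α : ℝ) (g : Fin n → Fin K) (M : Matrix (Fin K) (Fin K) ℝ)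
    (c : Fin K → ℝ) (q : Fin n → ℝ) (X : Matrix (Fin n) (Fin n) ℝ) :
    Matrix (Fin n) (Fin n) ℝ :=
  (√(n : ℝ))⁻¹ • (diagPow q (-α) * X * diagPow q (-α))
    + spikeU α g q X * spikeΛ M c * (spikeU α g q X)ᵀ

/-- Operator norm of a real matrix acting on Euclidean space. -/
def opNorm {n : ℕ} (B : Matrix (Fin n) (Fin n) ℝ) : ℝ :=
  ‖Matrix.toEuclideanCLM (n := Fin n) (𝕜 := ℝ) B‖

end DCSBM

end

/-!
Write `Q = ∑ q`, `x = X 1`, and let `w k` be the share of the total weight `Q` that is carried by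
the class `k`. Then `d i = q i Q (1 + δ i)` and `2m = Q² (1 + e)` hold exactly, with
`δ i = (M w)_{g i} / √n + x i / (q i Q)` and `e = wᵀ M w / √n + 1ᵀ x / Q²` (`degree_eq`,
`total_eq`). With `τ = √(8 log n) / √n`, all of these deviations are `O(τ)` almost surely.

Powers of `Q` cancel in the modularity matrix (`modularity_apply_eq`), whose entries become
`n^{-1/2} ρ i ρ j (X i j + q i q j R i j)`, where `ρ i = q i ^ (-α) (1 + O(τ))` and
`R i j = 1 + M_{g i g j} / √n - (1 + δ i) (1 + δ j) / (1 + e)`. The entries of the spiked model are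
`n^{-1/2} q i ^ (-α) q j ^ (-α) (X i j + q i q j R' i j)` (`spikedModel_apply`), where `R'` is the
first order expansion of `R` with `w` replaced by `c` and with `1ᵀ x / Q²` left out. The
deterministic parts are compared entry by entry, since the operator norm is at most `n` times the
largest entry: `√n |R - R'|` tends to zero because `w → c`, `1ᵀ x / Q² = O(τ / √n)` and
`√n τ² → 0`, and `R = O(τ)` absorbs the change from `q i ^ (-α)` to `ρ i`. In the noise part this
change costs `O(τ ‖X‖ / √n)`, so that `‖X‖ = o(n / √(log n))` suffices. Such a bound is much weaker
than the true order `√n` and follows from `‖X‖² = ‖X Xᵀ‖` and a bound on the inner products of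
distinct rows of `X` (`Concentrated.opNorm_noise_sq_le`). All of this is collected in
`Concentrated.opNorm_modularity_sub_spikedModel_le`.

The random input is thus reduced to Hoeffding bounds for row sums, inner products of two rows, and
the total sum of the noise, and for the sums of the weights over each class (`Concentrated`). For
fixed weights the first three are sums of independent centred functions of the coin flips that
determine the edges; in the inner product of rows `i` and `j`, the `k`-th term only involves the
edges `{i, k}` and `{j, k}`. The bounds pass to the random graph by integrating the conditional law
over the weights (`IsDCSBM.measureReal_le`), and Borel–Cantelli finishes the argument
(`ae_eventually_concentrated`).
-/

noncomputable section

namespace DCSBM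

/-! ### Sub-Gaussian tails -/

section SubGaussian

variable {Ω' : Type*} [MeasurableSpace Ω'] {ν : Measure Ω'}

/-- A sub-Gaussian variable with variance proxy at most `N` exceeds `√N · √(8 log n)` in absolute
value with probability at most `2 n⁻⁴`. The constant `8` makes this bound summable in `n` even after
a union bound over all pairs of nodes. -/
lemma measureReal_le_abs_of_hasSubgaussianMGF [IsProbabilityMeasure ν] {X : Ω' → ℝ}
    {v : NNReal} (hX : HasSubgaussianMGF X v ν) {N : ℝ} (hN : 0 < N) (hv : (v : ℝ) ≤ N)
    {n : ℕ} (hn : 1 ≤ n) :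
    ν.real {ω | √N * √(8 * Real.log n) ≤ |X ω|} ≤ 2 * (n : ℝ)⁻¹ ^ 4 := by
  have hn' : (0 : ℝ) < n := by exact_mod_cast hn
  have hlog : 0 ≤ Real.log n := Real.log_nonneg (by exact_mod_cast hn)
  lift N to NNReal using hN.le
  -- A larger variance proxy is harmless, and a positive one is needed: Mathlib's tail bound is
  -- trivial for proxy `0`, where its exponent is a division by zero.
  have mono : ∀ {Z : Ω' → ℝ}, HasSubgaussianMGF Z v ν → HasSubgaussianMGF Z N ν :=
    fun hZ => ⟨hZ.integrable_exp_mul, fun t => (hZ.mgf_le t).trans (by gcongr)⟩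
  have key : Real.exp (-(√N * √(8 * Real.log n)) ^ 2 / (2 * N)) = (n : ℝ)⁻¹ ^ 4 := by
    rw [mul_pow, Real.sq_sqrt N.coe_nonneg, Real.sq_sqrt (by positivity)]
    have : -(N * (8 * Real.log n)) / (2 * N) = ((4 : ℕ) : ℝ) * Real.log (n : ℝ)⁻¹ := by
      rw [Real.log_inv]; field_simp; push_cast; ring
    rw [this, ← Real.log_pow, Real.exp_log (by positivity)]
  have h1 := (mono hX).measure_ge_le (ε := √N * √(8 * Real.log n)) (by positivity)
  have h2 := (mono hX.neg).measure_ge_le (ε := √N * √(8 * Real.log n)) (by positivity)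
  rw [key] at h1 h2
  have hsub : {ω | √N * √(8 * Real.log n) ≤ |X ω|} ⊆
      {ω | √N * √(8 * Real.log n) ≤ X ω} ∪ {ω | √N * √(8 * Real.log n) ≤ (-X) ω} :=
    fun ω hω => by simpa [le_abs] using hω
  calc _ ≤ _ := measureReal_mono hsub
    _ ≤ _ := measureReal_union_le _ _
    _ ≤ _ := by linarith

lemma hasSubgaussianMGF_one_of_abs_le_one [IsProbabilityMeasure ν] {X : Ω' → ℝ}
    (hX : Measurable X) (hb : ∀ᵐ ω ∂ν, |X ω| ≤ 1) (h0 : ∫ ω, X ω ∂ν = 0) :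
    HasSubgaussianMGF X 1 ν := by
  have h := hasSubgaussianMGF_of_mem_Icc_of_integral_eq_zero (a := -1) (b := 1) hX.aemeasurable
    (by filter_upwards [hb] with ω h using abs_le.1 h) h0
  have e : (‖(1 : ℝ) - (-1)‖₊ / 2) ^ 2 = 1 := by
    ext; push_cast; norm_num
  rwa [e] at h

/-- **Hoeffding**: a sum of independent centred variables bounded by `1`. -/
lemma hasSubgaussianMGF_sum_of_abs_le_one {ι : Type*} [IsProbabilityMeasure ν] {f : ι → Ω' → ℝ}
    (hf : iIndepFun f ν) (hm : ∀ i, Measurable (f i)) (hb : ∀ i, ∀ᵐ ω ∂ν, |f i ω| ≤ 1)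
    (h0 : ∀ i, ∫ ω, f i ω ∂ν = 0) (s : Finset ι) :
    HasSubgaussianMGF (fun ω => ∑ i ∈ s, f i ω) s.card ν := by
  have := HasSubgaussianMGF.sum_of_iIndepFun hf (c := fun _ => 1) (s := s)
    (fun i _ => hasSubgaussianMGF_one_of_abs_le_one (hm i) (hb i) (h0 i))
  simpa using this

/-- A decoupled quadratic form in independent centred variables bounded by `1`: if the indices
`a k`, `b k` (`k ∈ s`) are pairwise different, the products `f (a k) * f (b k)` are independent and
centred, so that their sum obeys the same sub-Gaussian bound as a linear sum. -/
lemma hasSubgaussianMGF_sum_mul_of_abs_le_one {ι κ : Type*} [DecidableEq ι] [DecidableEq κ]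
    [IsProbabilityMeasure ν]
    {f : ι → Ω' → ℝ} (hf : iIndepFun f ν) (hm : ∀ i, Measurable (f i))
    (hb : ∀ i, ∀ᵐ ω ∂ν, |f i ω| ≤ 1) (h0 : ∀ i, ∫ ω, f i ω ∂ν = 0)
    {a b : κ → ι} (ha : a.Injective) (hb' : b.Injective) (s : Finset κ)
    (hab : ∀ k ∈ s, ∀ l ∈ s, a k ≠ b l) :
    HasSubgaussianMGF (fun ω => ∑ k ∈ s, f (a k) ω * f (b k) ω) s.card ν := by
  induction s using Finset.induction_on with
  | empty => simp
  | insert k s hk ih =>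
    have ih := ih fun x hx y hy => hab x (by simp [hx]) y (by simp [hy])
    have hne : a k ≠ b k := hab k (by simp) k (by simp)
    have h1 : HasSubgaussianMGF (fun ω => f (a k) ω * f (b k) ω) 1 ν := by
      refine hasSubgaussianMGF_one_of_abs_le_one ((hm _).mul (hm _)) ?_ ?_
      · filter_upwards [hb (a k), hb (b k)] with ω h1 h2
        rw [abs_mul]
        exact mul_le_one₀ h1 (abs_nonneg _) h2
      · rw [(hf.indepFun hne).integral_fun_mul_eq_mul_integral (hm _).aestronglyMeasurable
          (hm _).aestronglyMeasurable, h0, zero_mul]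
    let S : Finset ι := {a k, b k}
    let T : Finset ι := s.image a ∪ s.image b
    have hST : Disjoint S T := by
      rw [Finset.disjoint_left]
      intro x hx hx'
      simp only [S, T, Finset.mem_insert, Finset.mem_singleton, Finset.mem_union,
        Finset.mem_image] at hx hx'
      rcases hx with rfl | rfl <;> rcases hx' with ⟨l, hl, h⟩ | ⟨l, hl, h⟩
      · exact hk (ha h ▸ hl)
      · exact hab k (by simp) l (by simp [hl]) h.symm
      · exact hab l (by simp [hl]) k (by simp) h
      · exact hk (hb' h ▸ hl)
    have hind := hf.indepFun_finset S T hST hm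
    have haS : a k ∈ S := by simp [S]
    have hbS : b k ∈ S := by simp [S]
    have haT : ∀ l : s, a l ∈ T := fun l => by
      simp only [T, Finset.mem_union, Finset.mem_image]; exact Or.inl ⟨l, l.2, rfl⟩
    have hbT : ∀ l : s, b l ∈ T := fun l => by
      simp only [T, Finset.mem_union, Finset.mem_image]; exact Or.inr ⟨l, l.2, rfl⟩
    have hind2 : IndepFun (fun ω => f (a k) ω * f (b k) ω)
        (fun ω => ∑ k ∈ s, f (a k) ω * f (b k) ω) ν := by
      have e : (fun ω => ∑ k ∈ s, f (a k) ω * f (b k) ω) =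
          (fun x : T → ℝ => ∑ l : s, x ⟨a l, haT l⟩ * x ⟨b l, hbT l⟩) ∘ fun ω (i : T) => f i ω :=
        funext fun w => (Finset.sum_coe_sort s fun l => f (a l) w * f (b l) w).symm
      rw [e]
      exact hind.comp (φ := fun x : S → ℝ => x ⟨a k, haS⟩ * x ⟨b k, hbS⟩)
        (ψ := fun x : T → ℝ => ∑ l : s, x ⟨a l, haT l⟩ * x ⟨b l, hbT l⟩)
        (by fun_prop) (by fun_prop)
    have := h1.add_of_indepFun ih hind2
    simp only [Finset.sum_insert hk, Finset.card_insert_of_notMem hk]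
    push_cast
    rwa [add_comm (s.card : NNReal) 1]

end SubGaussian

/-! ### The graph as a function of independent coin flips -/

section EdgeMeasure

variable {n K : ℕ}

/-- Independent Bernoulli variables, one for each ordered pair of vertices. -/
def edgeMeasure (p : Fin n → Fin n → unitInterval) : Measure (Fin n × Fin n → Bool) :=
  Measure.pi fun e => bernoulliMeasure true false (p e.1 e.2)

instance (p : Fin n → Fin n → unitInterval) : IsProbabilityMeasure (edgeMeasure p) := by
  unfold edgeMeasure; infer_instance

/-- The ordered pair that stands for the edge `{i, j}`. -/
def edgeKey (i j : Fin n) : Fin n × Fin n := (min i j, max i j)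

lemma edgeKey_comm (i j : Fin n) : edgeKey i j = edgeKey j i := by
  simp [edgeKey, min_comm, max_comm]

lemma edgeKey_of_lt {i j : Fin n} (h : i < j) : edgeKey i j = (i, j) := by
  simp [edgeKey, h.le]

lemma edgeKey_eq_edgeKey {i j k l : Fin n} (h : edgeKey i j = edgeKey k l) :
    (i = k ∧ j = l) ∨ (i = l ∧ j = k) := by
  simp only [edgeKey, Prod.mk.injEq] at h
  rcases le_total i j with h1 | h1 <;> rcases le_total k l with h2 | h2 <;>
    simp only [h1, h2, min_eq_left, min_eq_right, max_eq_left, max_eq_right] at h <;> tauto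

lemma edgeKey_injective (i : Fin n) : (edgeKey i).Injective := fun j k h => by
  rcases edgeKey_eq_edgeKey h with h | h
  · exact h.2
  · exact h.2.trans h.1

/-- The graph whose edges are the pairs with a successful coin flip; only the coins of the pairs
`(i, j)` with `i < j` matter. -/
def edgeGraph (σ : Fin n × Fin n → Bool) : SimpleGraph (Fin n) where
  Adj i j := i ≠ j ∧ σ (edgeKey i j) = true
  symm := ⟨fun i j h => ⟨h.1.symm, edgeKey_comm i j ▸ h.2⟩⟩
  loopless := ⟨fun _ h => h.1 rfl⟩

open Classical in
lemma edgeGraph_eq_iff (σ : Fin n × Fin n → Bool) (H : SimpleGraph (Fin n)) :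
    edgeGraph σ = H ↔ ∀ i j, i < j → σ (i, j) = decide (H.Adj i j) := by
  constructor
  · rintro rfl i j hij
    simp [edgeGraph, edgeKey_of_lt hij, hij.ne]
  · intro h
    ext i j
    rcases lt_trichotomy i j with hij | rfl | hij
    · simp [edgeGraph, edgeKey_of_lt hij, hij.ne, h i j hij]
    · simp
    · simp [edgeGraph, edgeKey_comm i j, edgeKey_of_lt hij, hij.ne', h j i hij, H.adj_comm]

open Classical in
lemma edgeMeasure_real_edgeGraph_eq (p : Fin n → Fin n → unitInterval)
    (H : SimpleGraph (Fin n)) :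
    (edgeMeasure p).real {σ | edgeGraph σ = H} =
      ∏ i, ∏ j ∈ Finset.Ioi i, if H.Adj i j then (p i j : ℝ) else 1 - p i j := by
  have hset : {σ | edgeGraph σ = H} = Set.univ.pi fun e : Fin n × Fin n =>
      if e.1 < e.2 then {decide (H.Adj e.1 e.2)} else Set.univ := by
    ext σ
    simp only [Set.mem_ofPred_eq, edgeGraph_eq_iff, Set.mem_univ_pi]
    constructor
    · rintro h ⟨i, j⟩
      by_cases hij : i < j <;> simp [hij, h]
    · intro h i j hij
      simpa [hij] using h (i, j)
  rw [hset, edgeMeasure, measureReal_def, Measure.pi_pi, ENNReal.toReal_prod,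
    Fintype.prod_prod_type]
  refine Finset.prod_congr rfl fun i _ => ?_
  rw [← Finset.prod_subset (Finset.subset_univ (Finset.Ioi i))]
  · refine Finset.prod_congr rfl fun j hj => ?_
    rw [Finset.mem_Ioi] at hj
    by_cases hH : H.Adj i j <;> simp [hj, hH]
  · intro j _ hj
    rw [Finset.mem_Ioi] at hj
    simp [hj]

/-- The centred coin flip at the pair `e`. -/
def centredFlip (p : Fin n → Fin n → unitInterval) (e : Fin n × Fin n)
    (σ : Fin n × Fin n → Bool) : ℝ :=
  (if σ e then 1 else 0) - p e.1 e.2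

lemma measurable_centredFlip (p : Fin n → Fin n → unitInterval) (e : Fin n × Fin n) :
    Measurable (centredFlip p e) := by
  have h : Measurable fun b : Bool => (if b then (1 : ℝ) else 0) - p e.1 e.2 :=
    measurable_of_finite _
  exact h.comp (measurable_pi_apply e)

lemma iIndepFun_centredFlip (p : Fin n → Fin n → unitInterval) :
    iIndepFun (centredFlip p) (edgeMeasure p) :=
  iIndepFun_pi (X := fun (e : Fin n × Fin n) (b : Bool) => (if b then (1 : ℝ) else 0) - p e.1 e.2)
    fun _ => (measurable_of_finite _).aemeasurable

lemma abs_centredFlip_le (p : Fin n → Fin n → unitInterval) (e : Fin n × Fin n)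
    (σ : Fin n × Fin n → Bool) : |centredFlip p e σ| ≤ 1 := by
  have h0 := (p e.1 e.2).2.1
  have h1 := (p e.1 e.2).2.2
  unfold centredFlip
  split_ifs <;> rw [abs_le] <;> constructor <;> linarith

lemma integral_centredFlip (p : Fin n → Fin n → unitInterval) (e : Fin n × Fin n) :
    ∫ σ, centredFlip p e σ ∂(edgeMeasure p) = 0 := by
  have h := (measurePreserving_eval (fun e : Fin n × Fin n =>
    bernoulliMeasure true false (p e.1 e.2)) e).map_eq
  have : ∫ σ, centredFlip p e σ ∂(edgeMeasure p) =
      ∫ b, ((if b then (1 : ℝ) else 0) - p e.1 e.2) ∂(bernoulliMeasure true false (p e.1 e.2)) := by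
    rw [← h, integral_map (measurable_pi_apply e).aemeasurable
      (measurable_of_finite _).aestronglyMeasurable]
    rfl
  rw [this, integral_bernoulliMeasure]
  simp
  ring

lemma noise_eq_sub_edgeProb (g : Fin n → Fin K) (M : Matrix (Fin K) (Fin K) ℝ) (q : Fin n → ℝ)
    (A : Matrix (Fin n) (Fin n) ℝ) (i j : Fin n) :
    noise g M q A i j = A i j - edgeProb g (classWeights n M) q i j := by
  simp [noise, edgeProb, classWeights]
  ring

lemma adjacency_apply (H : SimpleGraph (Fin n)) (i j : Fin n) [Decidable (H.Adj i j)] :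
    adjacency H i j = if H.Adj i j then 1 else 0 := by
  simp [adjacency, SimpleGraph.adjMatrix_apply]

lemma adjacency_comm (H : SimpleGraph (Fin n)) (i j : Fin n) :
    adjacency H i j = adjacency H j i := by
  classical
  simp [adjacency_apply, H.adj_comm]

lemma edgeProb_comm {g : Fin n → Fin K} {C : Matrix (Fin K) (Fin K) ℝ} (hC : C.IsSymm)
    (q : Fin n → ℝ) (i j : Fin n) : edgeProb g C q i j = edgeProb g C q j i := by
  simp only [edgeProb, hC.apply (g i) (g j)]
  ring

lemma noise_comm {g : Fin n → Fin K} {M : Matrix (Fin K) (Fin K) ℝ}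
    (hC : (classWeights n M).IsSymm) (q : Fin n → ℝ) (H : SimpleGraph (Fin n)) (i j : Fin n) :
    noise g M q (adjacency H) i j = noise g M q (adjacency H) j i := by
  rw [noise_eq_sub_edgeProb, noise_eq_sub_edgeProb, adjacency_comm, edgeProb_comm hC]

/-- Edge probabilities, clamped to `[0, 1]`. -/
def clampedProb (g : Fin n → Fin K) (C : Matrix (Fin K) (Fin K) ℝ) (q : Fin n → ℝ)
    (i j : Fin n) : unitInterval :=
  Set.projIcc 0 1 zero_le_one (edgeProb g C q i j)

lemma clampedProb_of_mem {g : Fin n → Fin K} {C : Matrix (Fin K) (Fin K) ℝ} {q : Fin n → ℝ}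
    {i j : Fin n} (h : edgeProb g C q i j ∈ Set.Ioo (0 : ℝ) 1) :
    (clampedProb g C q i j : ℝ) = edgeProb g C q i j := by
  rw [clampedProb, Set.projIcc_of_mem _ (Set.Ioo_subset_Icc_self h)]

lemma noise_edgeGraph {g : Fin n → Fin K} {M : Matrix (Fin K) (Fin K) ℝ}
    (hC : (classWeights n M).IsSymm) {q : Fin n → ℝ}
    (hq : ∀ i j, i ≠ j → edgeProb g (classWeights n M) q i j ∈ Set.Ioo (0 : ℝ) 1)
    (σ : Fin n × Fin n → Bool) {i j : Fin n} (hij : i ≠ j) :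
    noise g M q (adjacency (edgeGraph σ)) i j =
      centredFlip (clampedProb g (classWeights n M) q) (edgeKey i j) σ := by
  classical
  wlog h : i < j generalizing i j
  · rw [noise_comm hC, edgeKey_comm]
    exact this hij.symm (lt_of_le_of_ne (not_lt.1 h) hij.symm)
  rw [noise_eq_sub_edgeProb, adjacency_apply, centredFlip, edgeKey_of_lt h,
    clampedProb_of_mem (hq i j hij)]
  simp [edgeGraph, edgeKey_of_lt h, hij]

lemma graphProb_eq_edgeMeasure {g : Fin n → Fin K} {C : Matrix (Fin K) (Fin K) ℝ}
    {q : Fin n → ℝ} (hq : ∀ i j, i ≠ j → edgeProb g C q i j ∈ Set.Ioo (0 : ℝ) 1)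
    (H : SimpleGraph (Fin n)) :
    graphProb g C q H = (edgeMeasure (clampedProb g C q)).real {σ | edgeGraph σ = H} := by
  classical
  rw [edgeMeasure_real_edgeGraph_eq, graphProb]
  refine Finset.prod_congr rfl fun i _ => Finset.prod_congr rfl fun j hj => ?_
  rw [Finset.mem_Ioi] at hj
  rw [clampedProb_of_mem (hq i j hj.ne)]

end EdgeMeasure

/-- A tail bound that holds for independent edges whose probabilities come from any admissible
weight vector holds for the graph of the model: integrate the conditional law over the weights. -/
lemma IsDCSBM.measureReal_le {Ω : Type*} [MeasurableSpace Ω] {P : Measure Ω}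
    [IsProbabilityMeasure P] {μ : Measure ℝ} {n K : ℕ} {g : Fin n → Fin K}
    {C : Matrix (Fin K) (Fin K) ℝ} {q : Fin n → Ω → ℝ} {G : Ω → SimpleGraph (Fin n)}
    (h : IsDCSBM P μ g C q G) (F : (Fin n → ℝ) → SimpleGraph (Fin n) → ℝ)
    (hF : ∀ H, Measurable fun w => F w H) {t r : ℝ}
    (hr : ∀ w, (∀ i j, i ≠ j → edgeProb g C w i j ∈ Set.Ioo (0 : ℝ) 1) →
      (edgeMeasure (clampedProb g C w)).real {σ | t ≤ |F w (edgeGraph σ)|} ≤ r) :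
    P.real {ω | t ≤ |F (fun i => q i ω) (G ω)|} ≤ r := by
  classical
  have hqm : Measurable fun ω i => q i ω := measurable_pi_lambda _ h.measurable_weight
  let S : SimpleGraph (Fin n) → Set Ω := fun H => {ω | t ≤ |F (fun i => q i ω) H|}
  have hSw : ∀ H, MeasurableSet {w | t ≤ |F w H|} := fun H =>
    measurableSet_le measurable_const (hF H).abs
  have hS : ∀ H, MeasurableSet (S H) := fun H => hqm (hSw H)
  have hint : ∀ H, Integrable (fun ω => graphProb g C (fun k => q k ω) H) P := fun H =>
    integrable_condExp.congr (h.cond_law H)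
  have h1 : ∀ H, P.real ({ω | G ω = H} ∩ S H) =
      ∫ ω, (S H).indicator (fun ω => graphProb g C (fun k => q k ω) H) ω ∂P := fun H => by
    rw [integral_indicator (hS H), ← setIntegral_congr_ae (hS H) ((h.cond_law H).mono
      fun ω hω _ => hω), setIntegral_condExp (s := S H) hqm.comap_le
      ((integrable_const 1).indicator (h.measurable_graph H)) ⟨_, hSw H, rfl⟩,
      integral_indicator (h.measurable_graph H)]
    simp [measureReal_restrict_apply (h.measurable_graph H)]
  have hsub : {ω | t ≤ |F (fun i => q i ω) (G ω)|} ⊆ ⋃ H, {ω | G ω = H} ∩ S H := fun ω hω => by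
    simp only [Set.mem_iUnion]
    exact ⟨G ω, rfl, hω⟩
  calc P.real {ω | t ≤ |F (fun i => q i ω) (G ω)|}
      ≤ P.real (⋃ H, {ω | G ω = H} ∩ S H) := measureReal_mono hsub
    _ ≤ ∑ H, P.real ({ω | G ω = H} ∩ S H) := measureReal_iUnion_fintype_le _
    _ = ∫ ω, ∑ H, (S H).indicator (fun ω => graphProb g C (fun k => q k ω) H) ω ∂P := by
        rw [integral_finsetSum _ fun H _ => (hint H).indicator (hS H)]
        exact Finset.sum_congr rfl fun H _ => h1 H
    _ ≤ ∫ _, r ∂P := by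
        refine integral_mono_ae (integrable_finsetSum _ fun H _ => (hint H).indicator (hS H))
          (integrable_const _) ?_
        filter_upwards [h.prob_mem] with ω hω
        refine le_trans (le_of_eq ?_) (hr _ hω)
        set w : Fin n → ℝ := fun k => q k ω
        have hu : {σ | t ≤ |F w (edgeGraph σ)|} =
            ⋃ H ∈ (Finset.univ.filter fun H => t ≤ |F w H|), {σ | edgeGraph σ = H} := by
          ext σ; simp
        rw [hu, measureReal_biUnion_finset, Finset.sum_filter]
        · refine Finset.sum_congr rfl fun H _ => ?_
          simp only [Set.indicator, S]
          congr 1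
          exact graphProb_eq_edgeMeasure hω H
        · intro H _ H' _ hne
          exact Set.disjoint_left.2 fun σ (h : _ = _) (h' : _ = _) => hne (h.symm.trans h')
        · exact fun _ _ => Set.Finite.measurableSet (Set.toFinite _)
    _ = r := by simp

/-! ### Concentration of degrees, codegrees and class weights -/

/-- The almost sure properties of the model that the comparison of the two matrices uses: with
`ℓ = √(8 log n)`, the row sums, the inner products of two rows and the total sum of the noise, and
the sums of the centred weights over each class, are within a factor `ℓ` of the square root of the
number of their terms. Diagonal entries of the noise, which are not centred, are left out. -/
structure Concentrated {n K : ℕ} (a m : ℝ) (g : Fin n → Fin K) (M : Matrix (Fin K) (Fin K) ℝ)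
    (q : Fin n → ℝ) (A : Matrix (Fin n) (Fin n) ℝ) : Prop where
  weight_mem : ∀ i, q i ∈ Set.Icc a 1
  row : ∀ i, |∑ j ∈ Finset.univ.erase i, noise g M q A i j| < √(n : ℝ) * √(8 * Real.log n)
  codegree : ∀ i j, i ≠ j →
    |∑ k ∈ Finset.univ.filter fun k => k ≠ i ∧ k ≠ j, noise g M q A i k * noise g M q A j k| <
      √(n : ℝ) * √(8 * Real.log n)
  total : |∑ e ∈ Finset.univ.filter fun e : Fin n × Fin n => e.1 < e.2, noise g M q A e.1 e.2| <
    √((n : ℝ) ^ 2) * √(8 * Real.log n)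
  classSum : ∀ k, |∑ i ∈ Finset.univ.filter fun i => g i = k, (q i - m)| <
    √(n : ℝ) * √(8 * Real.log n)

lemma exists_pos_forall_mem_Icc_of_support {μ : Measure ℝ} [IsProbabilityMeasure μ]
    (hμ_compact : IsCompact μ.support) (hμ_sub : μ.support ⊆ Set.Ioo (0 : ℝ) 1) :
    ∃ a, 0 < a ∧ ∀ᵐ x ∂μ, x ∈ Set.Icc a 1 := by
  obtain ⟨a, ha, hmin⟩ := hμ_compact.exists_isLeast
    (Measure.nonempty_support (IsProbabilityMeasure.ne_zero μ))
  refine ⟨a, (hμ_sub ha).1, ?_⟩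
  filter_upwards [Measure.support_mem_ae (μ := μ)] with x hx
  exact ⟨hmin hx, (hμ_sub hx).2.le⟩

lemma IsDCSBM.ae_weight_mem {Ω : Type*} [MeasurableSpace Ω] {P : Measure Ω} {μ : Measure ℝ}
    {n K : ℕ} {g : Fin n → Fin K} {q : Fin n → Ω → ℝ} {G : Ω → SimpleGraph (Fin n)} {a : ℝ}
    {C : Matrix (Fin K) (Fin K) ℝ} (h : IsDCSBM P μ g C q G)
    (hμ : ∀ᵐ x ∂μ, x ∈ Set.Icc a 1) : ∀ᵐ ω ∂P, ∀ i, q i ω ∈ Set.Icc a 1 := by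
  rw [ae_all_iff]
  intro i
  rw [← h.law_weight i] at hμ
  exact ae_of_ae_map (h.measurable_weight i).aemeasurable hμ

section Tails

variable {Ω : Type*} [MeasurableSpace Ω] {P : Measure Ω} [IsProbabilityMeasure P]
  {μ : Measure ℝ} {n K : ℕ} {g : Fin n → Fin K} {M : Matrix (Fin K) (Fin K) ℝ}
  {q : Fin n → Ω → ℝ} {G : Ω → SimpleGraph (Fin n)}

lemma measurable_noise (H : SimpleGraph (Fin n)) (i j : Fin n) :
    Measurable fun w : Fin n → ℝ => noise g M w (adjacency H) i j := by
  simp only [noise, Matrix.of_apply]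
  fun_prop

lemma IsDCSBM.measureReal_row_le (h : IsDCSBM P μ g (classWeights n M) q G) (hn : 1 ≤ n)
    (i : Fin n) :
    P.real {ω | √(n : ℝ) * √(8 * Real.log n) ≤ |∑ j ∈ Finset.univ.erase i,
      noise g M (fun k => q k ω) (adjacency (G ω)) i j|} ≤ 2 * (n : ℝ)⁻¹ ^ 4 := by
  refine h.measureReal_le (fun w H => ∑ j ∈ Finset.univ.erase i, noise g M w (adjacency H) i j)
    (fun H => Finset.measurable_sum _ fun j _ => measurable_noise H i j) fun w hw => ?_
  set p := clampedProb g (classWeights n M) w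
  have hs := hasSubgaussianMGF_sum_of_abs_le_one
    ((iIndepFun_centredFlip p).precomp (edgeKey_injective i))
    (fun _ => measurable_centredFlip p _) (fun _ => ae_of_all _ (abs_centredFlip_le p _))
    (fun _ => integral_centredFlip p _) (Finset.univ.erase i)
  have hc : (((Finset.univ.erase i).card : NNReal) : ℝ) ≤ n := by
    have := Finset.card_le_univ (Finset.univ.erase i)
    rw [Fintype.card_fin] at this
    exact_mod_cast this
  refine le_trans (le_of_eq ?_)
    (measureReal_le_abs_of_hasSubgaussianMGF hs (by exact_mod_cast hn) hc hn)
  congr 1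
  ext σ
  simp only [Set.mem_ofPred_eq]
  rw [Finset.sum_congr rfl fun j hj =>
    noise_edgeGraph h.symm hw σ (Finset.ne_of_mem_erase hj).symm]

lemma IsDCSBM.measureReal_codegree_le (h : IsDCSBM P μ g (classWeights n M) q G) (hn : 1 ≤ n)
    {i j : Fin n} (hij : i ≠ j) :
    P.real {ω | √(n : ℝ) * √(8 * Real.log n) ≤
      |∑ k ∈ Finset.univ.filter fun k => k ≠ i ∧ k ≠ j,
        noise g M (fun k => q k ω) (adjacency (G ω)) i k *
          noise g M (fun k => q k ω) (adjacency (G ω)) j k|} ≤ 2 * (n : ℝ)⁻¹ ^ 4 := by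
  refine h.measureReal_le (fun w H => ∑ k ∈ Finset.univ.filter fun k => k ≠ i ∧ k ≠ j,
    noise g M w (adjacency H) i k * noise g M w (adjacency H) j k)
    (fun H => Finset.measurable_sum _ fun k _ =>
      (measurable_noise H i k).mul (measurable_noise H j k)) fun w hw => ?_
  set p := clampedProb g (classWeights n M) w
  have hs := hasSubgaussianMGF_sum_mul_of_abs_le_one (iIndepFun_centredFlip p)
    (measurable_centredFlip p) (fun _ => ae_of_all _ (abs_centredFlip_le p _))
    (integral_centredFlip p) (edgeKey_injective i) (edgeKey_injective j)
    (Finset.univ.filter fun k => k ≠ i ∧ k ≠ j) (by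
      intro k hk l _ he
      rcases edgeKey_eq_edgeKey he with he | he
      · exact hij he.1
      · exact (Finset.mem_filter.1 hk).2.2 he.2)
  have hc : (((Finset.univ.filter fun k => k ≠ i ∧ k ≠ j).card : NNReal) : ℝ) ≤ n := by
    have := Finset.card_le_univ (Finset.univ.filter fun k => k ≠ i ∧ k ≠ j)
    rw [Fintype.card_fin] at this
    exact_mod_cast this
  refine le_trans (le_of_eq ?_)
    (measureReal_le_abs_of_hasSubgaussianMGF hs (by exact_mod_cast hn) hc hn)
  congr 1
  ext σ
  simp only [Set.mem_ofPred_eq]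
  rw [Finset.sum_congr rfl fun k hk => by
    rw [noise_edgeGraph h.symm hw σ (Finset.mem_filter.1 hk).2.1.symm,
      noise_edgeGraph h.symm hw σ (Finset.mem_filter.1 hk).2.2.symm]]

lemma IsDCSBM.measureReal_total_le (h : IsDCSBM P μ g (classWeights n M) q G) (hn : 1 ≤ n) :
    P.real {ω | √((n : ℝ) ^ 2) * √(8 * Real.log n) ≤
      |∑ e ∈ Finset.univ.filter fun e : Fin n × Fin n => e.1 < e.2,
        noise g M (fun k => q k ω) (adjacency (G ω)) e.1 e.2|} ≤ 2 * (n : ℝ)⁻¹ ^ 4 := by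
  refine h.measureReal_le (fun w H => ∑ e ∈ Finset.univ.filter fun e : Fin n × Fin n => e.1 < e.2,
    noise g M w (adjacency H) e.1 e.2)
    (fun H => Finset.measurable_sum _ fun e _ => measurable_noise H e.1 e.2) fun w hw => ?_
  set p := clampedProb g (classWeights n M) w
  have hs := hasSubgaussianMGF_sum_of_abs_le_one (iIndepFun_centredFlip p)
    (measurable_centredFlip p) (fun _ => ae_of_all _ (abs_centredFlip_le p _))
    (integral_centredFlip p) (Finset.univ.filter fun e : Fin n × Fin n => e.1 < e.2)
  have hc : (((Finset.univ.filter fun e : Fin n × Fin n => e.1 < e.2).card : NNReal) : ℝ)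
      ≤ (n : ℝ) ^ 2 := by
    have := Finset.card_le_univ (Finset.univ.filter fun e : Fin n × Fin n => e.1 < e.2)
    rw [Fintype.card_prod, Fintype.card_fin, ← sq] at this
    exact_mod_cast this
  refine le_trans (le_of_eq ?_)
    (measureReal_le_abs_of_hasSubgaussianMGF hs (by positivity) hc hn)
  congr 1
  ext σ
  simp only [Set.mem_ofPred_eq]
  rw [Finset.sum_congr rfl fun e he => by
    rw [noise_edgeGraph h.symm hw σ (Finset.mem_filter.1 he).2.ne,
      edgeKey_of_lt (Finset.mem_filter.1 he).2]]

variable {a : ℝ}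

lemma IsDCSBM.measureReal_classSum_le {C : Matrix (Fin K) (Fin K) ℝ} (h : IsDCSBM P μ g C q G)
    [IsProbabilityMeasure μ] (ha : 0 < a) (hμ : ∀ᵐ x ∂μ, x ∈ Set.Icc a 1) (hn : 1 ≤ n)
    (k : Fin K) :
    P.real {ω | √(n : ℝ) * √(8 * Real.log n) ≤
      |∑ i ∈ Finset.univ.filter fun i => g i = k, (q i ω - ∫ x, x ∂μ)|} ≤
        2 * (n : ℝ)⁻¹ ^ 4 := by
  have hint : Integrable (fun x : ℝ => x) μ := Integrable.of_mem_Icc a 1 aemeasurable_id hμ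
  have hm0 : 0 ≤ ∫ x, x ∂μ := integral_nonneg_of_ae (by
    filter_upwards [hμ] with x hx using ha.le.trans hx.1)
  have hm1 : ∫ x, x ∂μ ≤ 1 := by
    have := integral_mono_ae hint (integrable_const 1) (by
      filter_upwards [hμ] with x hx using hx.2)
    simpa using this
  have hw := h.ae_weight_mem hμ
  have hs := hasSubgaussianMGF_sum_of_abs_le_one (ν := P) (f := fun i ω => q i ω - ∫ x, x ∂μ)
    (h.indep_weight.comp (fun _ x => x - ∫ x, x ∂μ) fun _ => by fun_prop)
    (fun i => (h.measurable_weight i).sub_const _)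
    (fun i => by
      filter_upwards [hw] with ω hω
      have h1 := (hω i).1
      have h2 := (hω i).2
      rw [abs_le]
      constructor <;> linarith)
    (fun i => by
      have hi : Integrable (q i) P := Integrable.of_mem_Icc a 1
        (h.measurable_weight i).aemeasurable (by filter_upwards [hw] with ω hω using hω i)
      have hmap : ∫ x, x ∂μ = ∫ ω, q i ω ∂P := by
        rw [← h.law_weight i]
        exact integral_map (h.measurable_weight i).aemeasurable aestronglyMeasurable_id
      rw [integral_sub hi (integrable_const _), hmap]
      simp)
    (Finset.univ.filter fun i => g i = k)
  have hc : (((Finset.univ.filter fun i => g i = k).card : NNReal) : ℝ) ≤ n := by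
    have := Finset.card_le_univ (Finset.univ.filter fun i => g i = k)
    rw [Fintype.card_fin] at this
    exact_mod_cast this
  exact measureReal_le_abs_of_hasSubgaussianMGF hs (by exact_mod_cast hn) hc hn

/-- Union bound over the `n² + n + K + 1` tail events. -/
lemma IsDCSBM.measureReal_not_concentrated_le (h : IsDCSBM P μ g (classWeights n M) q G)
    [IsProbabilityMeasure μ] (ha : 0 < a) (hμ : ∀ᵐ x ∂μ, x ∈ Set.Icc a 1) (hn : 1 ≤ n) :
    P.real {ω | ¬ Concentrated a (∫ x, x ∂μ) g M (fun i => q i ω) (adjacency (G ω))} ≤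
      (2 * (K + 3)) * (n : ℝ)⁻¹ ^ 2 := by
  set r : ℝ := 2 * (n : ℝ)⁻¹ ^ 4 with hr
  have hr0 : 0 ≤ r := by positivity
  let S₀ : Set Ω := {ω | ¬ ∀ i, q i ω ∈ Set.Icc a 1}
  let S₁ : Fin n → Set Ω := fun i => {ω | √(n : ℝ) * √(8 * Real.log n) ≤
    |∑ j ∈ Finset.univ.erase i, noise g M (fun k => q k ω) (adjacency (G ω)) i j|}
  let S₂ : Fin n → Fin n → Set Ω := fun i j => {ω | i ≠ j ∧ √(n : ℝ) * √(8 * Real.log n) ≤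
    |∑ k ∈ Finset.univ.filter fun k => k ≠ i ∧ k ≠ j,
      noise g M (fun k => q k ω) (adjacency (G ω)) i k *
        noise g M (fun k => q k ω) (adjacency (G ω)) j k|}
  let S₃ : Set Ω := {ω | √((n : ℝ) ^ 2) * √(8 * Real.log n) ≤
    |∑ e ∈ Finset.univ.filter fun e : Fin n × Fin n => e.1 < e.2,
      noise g M (fun k => q k ω) (adjacency (G ω)) e.1 e.2|}
  let S₄ : Fin K → Set Ω := fun k => {ω | √(n : ℝ) * √(8 * Real.log n) ≤
    |∑ i ∈ Finset.univ.filter fun i => g i = k, (q i ω - ∫ x, x ∂μ)|}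
  have h0 : P.real S₀ = 0 := by
    rw [measureReal_def, show P S₀ = 0 from h.ae_weight_mem hμ, ENNReal.toReal_zero]
  have h1 : P.real (⋃ i, S₁ i) ≤ n * r := by
    refine (measureReal_iUnion_fintype_le _).trans
      ((Finset.sum_le_sum fun i _ => h.measureReal_row_le hn i).trans (by simp [hr]))
  have h2 : P.real (⋃ i, ⋃ j, S₂ i j) ≤ n * (n * r) := by
    have hS₂ : ∀ i j, P.real (S₂ i j) ≤ r := fun i j => by
      by_cases hij : i = j
      · simpa [S₂, hij] using hr0
      · simpa [S₂, hij, hr] using h.measureReal_codegree_le hn hij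
    have hS₂' : ∀ i, P.real (⋃ j, S₂ i j) ≤ n * r := fun i =>
      (measureReal_iUnion_fintype_le _).trans
        ((Finset.sum_le_sum fun j _ => hS₂ i j).trans (by simp))
    exact (measureReal_iUnion_fintype_le _).trans
      ((Finset.sum_le_sum fun i _ => hS₂' i).trans (by simp))
  have h3 : P.real S₃ ≤ r := h.measureReal_total_le hn
  have h4 : P.real (⋃ k, S₄ k) ≤ K * r :=
    (measureReal_iUnion_fintype_le _).trans
      ((Finset.sum_le_sum fun k _ => h.measureReal_classSum_le ha hμ hn k).trans (by simp [hr]))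
  have hsub : {ω | ¬ Concentrated a (∫ x, x ∂μ) g M (fun i => q i ω) (adjacency (G ω))} ⊆
      S₀ ∪ (⋃ i, S₁ i) ∪ (⋃ i, ⋃ j, S₂ i j) ∪ S₃ ∪ ⋃ k, S₄ k := by
    intro ω hω
    by_contra hcon
    simp only [Set.mem_union, Set.mem_iUnion, not_or, not_exists, S₀, S₁, S₂, S₃, S₄,
      Set.mem_ofPred_eq, not_and, not_not, not_le] at hcon hω
    exact hω ⟨hcon.1.1.1.1, hcon.1.1.1.2, hcon.1.1.2, hcon.1.2, hcon.2⟩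
  have hn1 : (1 : ℝ) ≤ n := by exact_mod_cast hn
  have hinv : (n : ℝ) ^ 2 * (n : ℝ)⁻¹ ^ 4 = (n : ℝ)⁻¹ ^ 2 := by
    field_simp
  calc _ ≤ _ := measureReal_mono hsub
    _ ≤ P.real S₀ + P.real (⋃ i, S₁ i) + P.real (⋃ i, ⋃ j, S₂ i j) + P.real S₃ +
        P.real (⋃ k, S₄ k) := by
      refine (measureReal_union_le _ _).trans ?_
      gcongr
      refine (measureReal_union_le _ _).trans ?_
      gcongr
      refine (measureReal_union_le _ _).trans ?_
      gcongr
      exact measureReal_union_le _ _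
    _ ≤ 0 + n * r + n * (n * r) + r + K * r := by rw [h0]; gcongr
    _ = (n + n * n + 1 + K) * r := by ring
    _ ≤ ((K + 3) * (n : ℝ) ^ 2) * r := by
      gcongr
      have hK : (0 : ℝ) ≤ K := by positivity
      nlinarith [mul_le_mul_of_nonneg_left (one_le_pow₀ hn1 (n := 2)) hK]
    _ = _ := by rw [hr, ← hinv]; ring

end Tails

/-- The tail events have summable probabilities, so Borel–Cantelli applies without any assumption
on the joint law of the graphs for different `n`. -/
lemma ae_eventually_concentrated {Ω : Type*} [MeasurableSpace Ω] {P : Measure Ω}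
    [IsProbabilityMeasure P] {μ : Measure ℝ} [IsProbabilityMeasure μ] {K : ℕ}
    {g : ∀ n : ℕ, Fin n → Fin K} {M : ℕ → Matrix (Fin K) (Fin K) ℝ}
    {q : ∀ n : ℕ, Fin n → Ω → ℝ} {G : ∀ n : ℕ, Ω → SimpleGraph (Fin n)}
    (hG : ∀ᶠ n in atTop, IsDCSBM P μ (g n) (classWeights n (M n)) (q n) (G n))
    {a : ℝ} (ha : 0 < a) (hμ : ∀ᵐ x ∂μ, x ∈ Set.Icc a 1) :
    ∀ᵐ ω ∂P, ∀ᶠ n in atTop, Concentrated a (∫ x, x ∂μ) (g n) (M n) (fun i => q n i ω)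
      (adjacency (G n ω)) := by
  obtain ⟨N, hN⟩ := eventually_atTop.1 (hG.and (eventually_ge_atTop 1))
  let B : ℕ → Set Ω := fun n => {ω | N ≤ n ∧ ¬ Concentrated a (∫ x, x ∂μ) (g n) (M n)
    (fun i => q n i ω) (adjacency (G n ω))}
  have hB : ∀ n, P (B n) ≤ ENNReal.ofReal ((2 * (K + 3)) * (n : ℝ)⁻¹ ^ 2) := fun n => by
    by_cases hn : N ≤ n
    · rw [← ofReal_measureReal]
      refine ENNReal.ofReal_le_ofReal ?_
      simpa [B, hn] using (hN n hn).1.measureReal_not_concentrated_le ha hμ (hN n hn).2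
    · simp [B, hn]
  have hsum : ∑' n, P (B n) ≠ ⊤ := by
    refine ne_top_of_le_ne_top ?_ (ENNReal.tsum_le_tsum hB)
    have : Summable fun n : ℕ => (2 * ((K : ℝ) + 3)) * (n : ℝ)⁻¹ ^ 2 := by
      simp only [inv_pow]
      exact (Real.summable_nat_pow_inv.2 one_lt_two).mul_left _
    exact this.tsum_ofReal_ne_top
  filter_upwards [ae_eventually_notMem hsum] with ω hω
  filter_upwards [hω, eventually_ge_atTop N] with n hn hNn
  by_contra hcon
  exact hn ⟨hNn, hcon⟩

/-! ### Operator norm bounds -/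

section OpNorm

open scoped Matrix.Norms.L2Operator

variable {n : ℕ}

lemma opNorm_nonneg (B : Matrix (Fin n) (Fin n) ℝ) : 0 ≤ opNorm B := norm_nonneg _

lemma opNorm_add_le (A B : Matrix (Fin n) (Fin n) ℝ) : opNorm (A + B) ≤ opNorm A + opNorm B :=
  norm_add_le A B

lemma opNorm_smul (t : ℝ) (B : Matrix (Fin n) (Fin n) ℝ) : opNorm (t • B) = |t| * opNorm B :=
  norm_smul t B

lemma opNorm_mul_le (A B : Matrix (Fin n) (Fin n) ℝ) : opNorm (A * B) ≤ opNorm A * opNorm B :=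
  Matrix.l2_opNorm_mul A B

lemma opNorm_mul_transpose (B : Matrix (Fin n) (Fin n) ℝ) : opNorm (B * Bᵀ) = opNorm B ^ 2 := by
  have h := Matrix.l2_opNorm_conjTranspose_mul_self Bᴴ
  rw [Matrix.conjTranspose_conjTranspose, Matrix.l2_opNorm_conjTranspose] at h
  rw [sq]
  exact h

lemma opNorm_diagonal_le {v : Fin n → ℝ} {b : ℝ} (hb : 0 ≤ b) (hv : ∀ i, |v i| ≤ b) :
    opNorm (Matrix.diagonal v) ≤ b :=
  (Matrix.l2_opNorm_diagonal v).le.trans ((pi_norm_le_iff_of_nonneg hb).2 hv)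

lemma opNorm_le_of_forall_abs_le {B : Matrix (Fin n) (Fin n) ℝ} {b : ℝ} (hb : 0 ≤ b)
    (hB : ∀ i j, |B i j| ≤ b) : opNorm B ≤ n * b := by
  refine ContinuousLinearMap.opNorm_le_bound _ (by positivity) fun x => ?_
  refine abs_le_of_sq_le_sq' ?_ (by positivity) |>.2
  rw [mul_pow, EuclideanSpace.real_norm_sq_eq, EuclideanSpace.real_norm_sq_eq]
  have hrow : ∀ i, (∑ j, B i j ^ 2) ≤ n * b ^ 2 := fun i => by
    calc ∑ j, B i j ^ 2 ≤ ∑ _j : Fin n, b ^ 2 :=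
          Finset.sum_le_sum fun j _ => sq_le_sq' (abs_le.1 (hB i j)).1 (abs_le.1 (hB i j)).2
      _ = n * b ^ 2 := by simp
  calc ∑ i, (Matrix.toEuclideanCLM (n := Fin n) (𝕜 := ℝ) B x).ofLp i ^ 2
      = ∑ i, (∑ j, B i j * x.ofLp j) ^ 2 := by
        simp [Matrix.mulVec, dotProduct]
    _ ≤ ∑ i, (∑ j, B i j ^ 2) * ∑ j, x.ofLp j ^ 2 :=
        Finset.sum_le_sum fun i _ => Finset.sum_mul_sq_le_sq_mul_sq _ _ _
    _ ≤ ∑ _i : Fin n, (n * b ^ 2) * ∑ j, x.ofLp j ^ 2 := by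
        gcongr with i
        exact hrow i
    _ = (n * b) ^ 2 * ∑ j, x.ofLp j ^ 2 := by
        simp only [Finset.sum_const, Finset.card_univ, Fintype.card_fin, nsmul_eq_mul]
        ring

/-- A matrix whose rows have squared length at most `n b₀` and inner products at most `b` has
squared operator norm at most `n (b₀ + b)`: split `B Bᵀ` into its diagonal and the rest. -/
lemma opNorm_sq_le_of_row_inner {B : Matrix (Fin n) (Fin n) ℝ} {b₀ b : ℝ} (hb₀ : 0 ≤ b₀)
    (hb : 0 ≤ b) (hdiag : ∀ i, |∑ k, B i k * B i k| ≤ n * b₀)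
    (hoff : ∀ i j, i ≠ j → |∑ k, B i k * B j k| ≤ b) :
    opNorm B ^ 2 ≤ n * (b₀ + b) := by
  rw [← opNorm_mul_transpose]
  set E : Matrix (Fin n) (Fin n) ℝ :=
    Matrix.of fun i j => if i = j then 0 else (B * Bᵀ) i j with hE
  have hsplit : B * Bᵀ = Matrix.diagonal (fun i => (B * Bᵀ) i i) + E := by
    ext i j
    by_cases hij : i = j
    · subst hij; simp [hE]
    · simp [hE, hij]
  rw [hsplit]
  calc _ ≤ _ := opNorm_add_le _ _
    _ ≤ n * b₀ + n * b := by
      gcongr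
      · exact opNorm_diagonal_le (by positivity) fun i => by
          simpa [Matrix.mul_apply] using hdiag i
      · refine opNorm_le_of_forall_abs_le hb fun i j => ?_
        by_cases hij : i = j
        · simpa [hE, hij] using hb
        · simpa [hE, hij, Matrix.mul_apply] using hoff i j hij
    _ = _ := by ring

/-- Effect on `D B D` of a perturbation of the diagonal matrix `D`. -/
lemma opNorm_diagonal_conj_sub_le (B : Matrix (Fin n) (Fin n) ℝ) {ρ r : Fin n → ℝ} {b ε : ℝ}
    (hb : 0 ≤ b) (hε : 0 ≤ ε) (hρ : ∀ i, |ρ i| ≤ b) (hr : ∀ i, |r i| ≤ b)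
    (hd : ∀ i, |ρ i - r i| ≤ ε) :
    opNorm (Matrix.diagonal ρ * B * Matrix.diagonal ρ - Matrix.diagonal r * B * Matrix.diagonal r)
      ≤ 2 * b * ε * opNorm B := by
  have hsplit : Matrix.diagonal ρ * B * Matrix.diagonal ρ -
      Matrix.diagonal r * B * Matrix.diagonal r =
      Matrix.diagonal (fun i => ρ i - r i) * B * Matrix.diagonal ρ +
      Matrix.diagonal r * B * Matrix.diagonal (fun i => ρ i - r i) := by
    ext i j
    simp only [Matrix.sub_apply, Matrix.add_apply, Matrix.mul_diagonal, Matrix.diagonal_mul]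
    ring
  rw [hsplit]
  have h1 := opNorm_diagonal_le hε hd
  have h2 := opNorm_diagonal_le hb hρ
  have h3 := opNorm_diagonal_le hb hr
  have hB := opNorm_nonneg B
  calc _ ≤ _ := opNorm_add_le _ _
    _ ≤ ε * opNorm B * b + b * opNorm B * ε := by
      gcongr
      · refine (opNorm_mul_le _ _).trans ?_
        gcongr
        · exact opNorm_nonneg _
        refine (opNorm_mul_le _ _).trans ?_
        gcongr
      · refine (opNorm_mul_le _ _).trans ?_
        gcongr
        · exact opNorm_nonneg _
        refine (opNorm_mul_le _ _).trans ?_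
        gcongr
    _ = _ := by ring

end OpNorm

/-! ### Degrees and entries of the two matrices -/

section Entries

variable {n K : ℕ}

/-- Share of the total weight that is carried by the class `k`. -/
def classShare (g : Fin n → Fin K) (q : Fin n → ℝ) (k : Fin K) : ℝ :=
  (∑ i ∈ Finset.univ.filter fun i => g i = k, q i) / ∑ i, q i

lemma sum_weight_mul_class (g : Fin n → Fin K) {q : Fin n → ℝ} (hQ : ∑ i, q i ≠ 0)
    (f : Fin K → ℝ) : ∑ i, q i * f (g i) = (∑ i, q i) * (f ⬝ᵥ classShare g q) := by
  rw [← Finset.sum_fiberwise Finset.univ g, dotProduct, Finset.mul_sum]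
  refine Finset.sum_congr rfl fun k _ => ?_
  rw [classShare, mul_left_comm, mul_div_cancel₀ _ hQ, mul_comm, Finset.sum_mul]
  refine Finset.sum_congr rfl fun i hi => ?_
  rw [(Finset.mem_filter.1 hi).2]

lemma sum_classShare (g : Fin n → Fin K) {q : Fin n → ℝ} (hQ : ∑ i, q i ≠ 0) :
    ∑ k, classShare g q k = 1 := by
  simp only [classShare, ← Finset.sum_div]
  rw [Finset.sum_fiberwise Finset.univ g q, div_self hQ]

lemma classShare_nonneg (g : Fin n → Fin K) {q : Fin n → ℝ} (hq : ∀ i, 0 ≤ q i) (k : Fin K) :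
    0 ≤ classShare g q k :=
  div_nonneg (Finset.sum_nonneg fun i _ => hq i) (Finset.sum_nonneg fun i _ => hq i)

/-- Relative deviation of the degree of `i` from `q i * ∑ q`. -/
def degreeDev (g : Fin n → Fin K) (M : Matrix (Fin K) (Fin K) ℝ) (q : Fin n → ℝ)
    (X : Matrix (Fin n) (Fin n) ℝ) (i : Fin n) : ℝ :=
  (√(n : ℝ))⁻¹ * (M *ᵥ classShare g q) (g i) + (X *ᵥ 1) i / (q i * ∑ j, q j)

/-- Relative deviation of the sum of all degrees from `(∑ q) ^ 2`. -/
def totalDev (g : Fin n → Fin K) (M : Matrix (Fin K) (Fin K) ℝ) (q : Fin n → ℝ)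
    (X : Matrix (Fin n) (Fin n) ℝ) : ℝ :=
  (√(n : ℝ))⁻¹ * (classShare g q ⬝ᵥ (M *ᵥ classShare g q)) + ((X *ᵥ 1) ⬝ᵥ 1) / (∑ j, q j) ^ 2

lemma degree_eq_add (g : Fin n → Fin K) (M : Matrix (Fin K) (Fin K) ℝ) {q : Fin n → ℝ}
    (A : Matrix (Fin n) (Fin n) ℝ) (hQ : ∑ j, q j ≠ 0) (i : Fin n) :
    (A *ᵥ 1) i = q i * (∑ j, q j) + (√(n : ℝ))⁻¹ * q i * (∑ j, q j) *
      (M *ᵥ classShare g q) (g i) + (noise g M q A *ᵥ 1) i := by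
  have h := sum_weight_mul_class g hQ (fun k => M (g i) k)
  have hA : ∀ j, A i j = q i * q j + (√(n : ℝ))⁻¹ * q i * (q j * M (g i) (g j)) +
      noise g M q A i j := fun j => by
    simp only [noise, Matrix.of_apply]; ring
  simp only [Matrix.mulVec, dotProduct, Pi.one_apply, mul_one] at h ⊢
  rw [Finset.sum_congr rfl fun j _ => hA j, Finset.sum_add_distrib, Finset.sum_add_distrib,
    ← Finset.mul_sum, ← Finset.mul_sum, h]
  ring

lemma degree_eq (g : Fin n → Fin K) (M : Matrix (Fin K) (Fin K) ℝ) {q : Fin n → ℝ}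
    (A : Matrix (Fin n) (Fin n) ℝ) (hQ : ∑ j, q j ≠ 0) {i : Fin n} (hi : q i ≠ 0) :
    (A *ᵥ 1) i = q i * (∑ j, q j) * (1 + degreeDev g M q (noise g M q A) i) := by
  rw [degree_eq_add g M A hQ, degreeDev]
  generalize (√(n : ℝ))⁻¹ = s
  field_simp
  ring

lemma total_eq (g : Fin n → Fin K) (M : Matrix (Fin K) (Fin K) ℝ) {q : Fin n → ℝ}
    (A : Matrix (Fin n) (Fin n) ℝ) (hQ : ∑ j, q j ≠ 0) :
    (A *ᵥ 1) ⬝ᵥ 1 = (∑ j, q j) ^ 2 * (1 + totalDev g M q (noise g M q A)) := by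
  have h := sum_weight_mul_class g hQ (fun k => (M *ᵥ classShare g q) k)
  have hsum : (A *ᵥ 1) ⬝ᵥ 1 = (∑ j, q j) * (∑ j, q j) +
      (√(n : ℝ))⁻¹ * (∑ j, q j) * ((∑ j, q j) * (classShare g q ⬝ᵥ (M *ᵥ classShare g q))) +
      (noise g M q A *ᵥ 1) ⬝ᵥ 1 := by
    rw [dotProduct_comm (classShare g q), ← h]
    simp only [dotProduct, Pi.one_apply, mul_one, degree_eq_add g M A hQ]
    rw [Finset.sum_add_distrib, Finset.sum_add_distrib, Finset.sum_mul, Finset.mul_sum]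
    congr 2
    refine Finset.sum_congr rfl fun i _ => ?_
    ring
  rw [hsum, totalDev]
  generalize (√(n : ℝ))⁻¹ = s
  field_simp
  ring

lemma modularity_apply (α : ℝ) (A : Matrix (Fin n) (Fin n) ℝ) (i j : Fin n) :
    modularity α A i j = ((A *ᵥ 1) ⬝ᵥ 1) ^ α * (√(n : ℝ))⁻¹ * ((A *ᵥ 1) i ^ (-α) *
      (A i j - (A *ᵥ 1) i * (A *ᵥ 1) j / ((A *ᵥ 1) ⬝ᵥ 1)) * (A *ᵥ 1) j ^ (-α)) := by
  simp only [modularity, diagPow, Matrix.smul_apply, Matrix.mul_diagonal, Matrix.diagonal_mul,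
    Matrix.sub_apply, Matrix.vecMulVec_apply, smul_eq_mul]
  ring

lemma centred_class_matrix_apply {M : Matrix (Fin K) (Fin K) ℝ} (hM : M.IsSymm) (c : Fin K → ℝ)
    (a b : Fin K) :
    ((1 - Matrix.vecMulVec 1 c) * M * (1 - Matrix.vecMulVec c 1) :
      Matrix (Fin K) (Fin K) ℝ) a b =
      M a b - (M *ᵥ c) a - (M *ᵥ c) b + c ⬝ᵥ (M *ᵥ c) := by
  have h : c ᵥ* M = M *ᵥ c := by
    rw [← Matrix.mulVec_transpose, hM.eq]
  have e : (1 - Matrix.vecMulVec 1 c) * M * (1 - Matrix.vecMulVec c 1) =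
      M - Matrix.vecMulVec 1 (c ᵥ* M) - Matrix.vecMulVec (M *ᵥ c) 1 +
        Matrix.vecMulVec 1 (c ᵥ* M) * Matrix.vecMulVec c 1 := by
    rw [Matrix.sub_mul, Matrix.mul_sub, Matrix.one_mul, Matrix.vecMulVec_mul, Matrix.mul_one,
      Matrix.sub_mul, Matrix.mul_vecMulVec]
    abel
  rw [e, h, Matrix.vecMulVec_mul_vecMulVec]
  simp [dotProduct_comm c]
  ring

lemma spikedModel_apply (α : ℝ) (g : Fin n → Fin K) {M : Matrix (Fin K) (Fin K) ℝ}
    (hM : M.IsSymm) (c : Fin K → ℝ) {q : Fin n → ℝ} (hq : ∀ i, 0 < q i)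
    (X : Matrix (Fin n) (Fin n) ℝ) (i j : Fin n) :
    spikedModel α g M c q X i j = (√(n : ℝ))⁻¹ * (q i ^ (-α) * q j ^ (-α) * (X i j +
      q i * q j * ((√(n : ℝ))⁻¹ * (M (g i) (g j) - (M *ᵥ c) (g i) - (M *ᵥ c) (g j) +
        c ⬝ᵥ (M *ᵥ c)) - (X *ᵥ 1) i / (q i * ∑ k, q k) - (X *ᵥ 1) j / (q j * ∑ k, q k)))) := by
  have hpow : ∀ i, q i ^ (1 - α) = q i * q i ^ (-α) := fun i => by
    rw [sub_eq_add_neg, Real.rpow_add (hq i), Real.rpow_one]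
  have hX : ∀ i, ((diagPow q (-α) * X) *ᵥ 1) i = q i ^ (-α) * (X *ᵥ 1) i := fun i => by
    rw [diagPow, ← Matrix.mulVec_mulVec, Matrix.mulVec_diagonal]
  have hQ : q ⬝ᵥ 1 = ∑ k, q k := by simp [dotProduct]
  have hUl : ∀ i k, spikeU α g q X i (Sum.inl k) =
      if g i = k then (√(n : ℝ))⁻¹ * (q i * q i ^ (-α)) else 0 := fun i k => by
    simp [spikeU, classIndicator, diagPow, Matrix.diagonal_mul, hpow]
  have hUr : ∀ i u, spikeU α g q X i (Sum.inr u) =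
      (∑ k, q k)⁻¹ * (q i ^ (-α) * (X *ᵥ 1) i) := fun i u => by
    simp [spikeU, hX, hQ]
  have hΛ : (spikeU α g q X * spikeΛ M c * (spikeU α g q X)ᵀ) i j =
      (√(n : ℝ))⁻¹ * (q i * q i ^ (-α)) * (M (g i) (g j) - (M *ᵥ c) (g i) - (M *ᵥ c) (g j) +
        c ⬝ᵥ (M *ᵥ c)) * ((√(n : ℝ))⁻¹ * (q j * q j ^ (-α))) -
      (∑ k, q k)⁻¹ * (q i ^ (-α) * (X *ᵥ 1) i) * ((√(n : ℝ))⁻¹ * (q j * q j ^ (-α))) -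
      (√(n : ℝ))⁻¹ * (q i * q i ^ (-α)) * ((∑ k, q k)⁻¹ * (q j ^ (-α) * (X *ᵥ 1) j)) := by
    rw [← centred_class_matrix_apply hM, spikeΛ]
    generalize ((1 - Matrix.vecMulVec 1 c) * M * (1 - Matrix.vecMulVec c 1) :
      Matrix (Fin K) (Fin K) ℝ) = W
    simp only [Matrix.mul_apply, Fintype.sum_sum_type, Matrix.transpose_apply, hUl, hUr,
      Matrix.fromBlocks_apply₁₁, Matrix.fromBlocks_apply₁₂, Matrix.fromBlocks_apply₂₁,
      Matrix.fromBlocks_apply₂₂, Matrix.neg_apply, Matrix.replicateCol_apply,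
      Matrix.replicateRow_apply, Matrix.zero_apply, Pi.one_apply, Finset.univ_unique,
      Finset.sum_singleton, ite_mul, mul_ite, zero_mul, mul_zero, Finset.sum_ite_eq,
      Finset.mem_univ, if_true, mul_neg, mul_one]
    ring
  have hqi := (hq i).ne'
  have hqj := (hq j).ne'
  simp only [spikedModel, diagPow, Matrix.add_apply, Matrix.smul_apply, Matrix.mul_diagonal,
    Matrix.diagonal_mul, smul_eq_mul, hΛ]
  generalize (√(n : ℝ))⁻¹ = s
  field_simp

end Entries

/-! ### Consequences of concentration for a fixed number of nodes -/

section Bounds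

variable {n K : ℕ} {a m B : ℝ} {g : Fin n → Fin K} {M : Matrix (Fin K) (Fin K) ℝ}
  {q : Fin n → ℝ} {H : SimpleGraph (Fin n)}

lemma isSymm_of_classWeights (hn : 0 < √(n : ℝ)) (hC : (classWeights n M).IsSymm) :
    M.IsSymm := by
  refine Matrix.IsSymm.ext fun k l => ?_
  have h := hC.apply k l
  simp only [classWeights, Matrix.of_apply, add_right_inj] at h
  exact (div_left_inj' hn.ne').1 h

lemma abs_noise_le (hq : ∀ i, q i ∈ Set.Icc a 1) (ha : 0 < a) (hM : ∀ k l, |M k l| ≤ B)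
    (hB : B ≤ √(n : ℝ)) (i j : Fin n) : |noise g M q (adjacency H) i j| ≤ 3 := by
  classical
  have hi := (hq i).1
  have hi' := (hq i).2
  have hj := (hq j).1
  have hj' := (hq j).2
  have hqq0 : 0 ≤ q i * q j := mul_nonneg (by linarith) (by linarith)
  have hqq1 : q i * q j ≤ 1 := mul_le_one₀ hi' (by linarith) hj'
  have hMn : |M (g i) (g j) / √(n : ℝ)| ≤ 1 := by
    rw [abs_div, abs_of_nonneg (Real.sqrt_nonneg _)]
    exact div_le_one_of_le₀ ((hM _ _).trans hB) (Real.sqrt_nonneg _)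
  have hA : |adjacency H i j| ≤ 1 := by
    rw [adjacency_apply]; split_ifs <;> simp
  have h2 : |q i * q j * (M (g i) (g j) / √(n : ℝ))| ≤ 1 := by
    rw [abs_mul, abs_of_nonneg hqq0]
    exact mul_le_one₀ hqq1 (abs_nonneg _) hMn
  simp only [noise, Matrix.of_apply]
  rw [abs_le] at hA h2 ⊢
  constructor <;> linarith

lemma Concentrated.abs_noise_mulVec_one_le (h : Concentrated a m g M q (adjacency H))
    (ha : 0 < a) (hM : ∀ k l, |M k l| ≤ B) (hB : B ≤ √(n : ℝ)) (hn : 3 ≤ √(n : ℝ))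
    (hL : 1 ≤ √(8 * Real.log n)) (i : Fin n) :
    |(noise g M q (adjacency H) *ᵥ 1) i| ≤ 2 * (√(n : ℝ) * √(8 * Real.log n)) := by
  have h1 := (h.row i).le
  have h2 := abs_noise_le (g := g) (H := H) h.weight_mem ha hM hB i i
  have h3 : √(n : ℝ) ≤ √(n : ℝ) * √(8 * Real.log n) := le_mul_of_one_le_right (by linarith) hL
  have e : (noise g M q (adjacency H) *ᵥ 1) i =
      noise g M q (adjacency H) i i +
        ∑ j ∈ Finset.univ.erase i, noise g M q (adjacency H) i j := by
    rw [Finset.add_sum_erase _ _ (Finset.mem_univ i)]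
    simp [Matrix.mulVec, dotProduct]
  rw [e]
  exact (abs_add_le _ _).trans (by linarith)

lemma Concentrated.abs_noise_total_le (h : Concentrated a m g M q (adjacency H))
    (hC : (classWeights n M).IsSymm)
    (ha : 0 < a) (hM : ∀ k l, |M k l| ≤ B) (hB : B ≤ √(n : ℝ)) (hL : 1 ≤ √(8 * Real.log n)) :
    |(noise g M q (adjacency H) *ᵥ 1) ⬝ᵥ 1| ≤ 5 * (n * √(8 * Real.log n)) := by
  set N := noise g M q (adjacency H) with hN
  have hsymm : ∀ i j, N i j = N j i := noise_comm hC q H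
  have htot := h.total.le
  rw [Real.sqrt_sq (Nat.cast_nonneg n)] at htot
  set U := ∑ e ∈ Finset.univ.filter fun e : Fin n × Fin n => e.1 < e.2, N e.1 e.2 with hU
  have hlow : ∑ e ∈ Finset.univ.filter fun e : Fin n × Fin n => e.2 < e.1, N e.1 e.2 = U := by
    refine Finset.sum_nbij' Prod.swap Prod.swap ?_ ?_ ?_ ?_ ?_
    · intro e he; simpa using he
    · intro e he; simpa using he
    · intro e _; simp
    · intro e _; simp
    · intro e _; exact hsymm _ _
  have hdiag : ∑ e ∈ Finset.univ.filter fun e : Fin n × Fin n => e.1 = e.2, N e.1 e.2 =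
      ∑ i, N i i := by
    refine Finset.sum_nbij' Prod.fst (fun i => (i, i)) ?_ ?_ ?_ ?_ ?_
    · intro e _; simp
    · intro i _; simp
    · rintro ⟨i, j⟩ he
      have : i = j := by simpa using he
      simp [this]
    · intro i _; rfl
    · rintro ⟨i, j⟩ he
      have : i = j := by simpa using he
      simp [this]
  have hsum : (N *ᵥ 1) ⬝ᵥ 1 = 2 * U + ∑ i, N i i := by
    have e1 : (N *ᵥ 1) ⬝ᵥ 1 = ∑ e : Fin n × Fin n, N e.1 e.2 := by
      simp [Matrix.mulVec, dotProduct, Fintype.sum_prod_type]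
    have e2 : ∀ e : Fin n × Fin n, N e.1 e.2 = (if e.1 < e.2 then N e.1 e.2 else 0) +
        (if e.2 < e.1 then N e.1 e.2 else 0) + (if e.1 = e.2 then N e.1 e.2 else 0) := by
      rintro ⟨i, j⟩
      rcases lt_trichotomy i j with hij | hij | hij
      · simp [hij, hij.not_gt, hij.ne]
      · simp [hij]
      · simp [hij, hij.not_gt, hij.ne']
    rw [e1, Finset.sum_congr rfl fun e _ => e2 e, Finset.sum_add_distrib, Finset.sum_add_distrib,
      ← Finset.sum_filter, ← Finset.sum_filter, ← Finset.sum_filter, hlow, hdiag]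
    ring
  have hd : |∑ i, N i i| ≤ n * 3 := by
    refine (Finset.abs_sum_le_sum_abs _ _).trans
      ((Finset.sum_le_sum fun i _ => abs_noise_le h.weight_mem ha hM hB i i).trans (by simp))
  have hnL : (n : ℝ) ≤ n * √(8 * Real.log n) := le_mul_of_one_le_right (Nat.cast_nonneg n) hL
  rw [hsum]
  have h2U : |2 * U| = 2 * |U| := by rw [abs_mul, abs_two]
  exact (abs_add_le _ _).trans (by linarith)

/-- The noise has operator norm `O(n^{3/4} (log n)^{1/4})`. This is weaker than the true order
`√n`, but the comparison only needs a bound that is `o(n / √(log n))`. -/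
lemma Concentrated.opNorm_noise_sq_le (h : Concentrated a m g M q (adjacency H))
    (ha : 0 < a) (hM : ∀ k l, |M k l| ≤ B) (hB : B ≤ √(n : ℝ)) (hn : 3 ≤ √(n : ℝ))
    (hL : 1 ≤ √(8 * Real.log n)) :
    opNorm (noise g M q (adjacency H)) ^ 2 ≤ n * (10 * (√(n : ℝ) * √(8 * Real.log n))) := by
  set N := noise g M q (adjacency H) with hN
  have hb : ∀ i j, |N i j| ≤ 3 := abs_noise_le h.weight_mem ha hM hB
  have hbb : ∀ i j k l, |N i j * N k l| ≤ 9 := fun i j k l => by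
    rw [abs_mul]
    calc _ ≤ (3 : ℝ) * 3 := mul_le_mul (hb i j) (hb k l) (abs_nonneg _) (by norm_num)
      _ = 9 := by norm_num
  have h3 : √(n : ℝ) ≤ √(n : ℝ) * √(8 * Real.log n) := le_mul_of_one_le_right (by linarith) hL
  refine (opNorm_sq_le_of_row_inner (b₀ := 9) (b := √(n : ℝ) * √(8 * Real.log n) + 18)
    (by norm_num) (by positivity) (fun i => ?_) fun i j hij => ?_).trans ?_
  · refine (Finset.abs_sum_le_sum_abs _ _).trans
      ((Finset.sum_le_sum fun k _ => hbb i k i k).trans (by simp))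
  · have hcomp : ∑ k, N i k * N j k =
        ∑ k ∈ Finset.univ.filter (fun k => k ≠ i ∧ k ≠ j), N i k * N j k +
          (N i i * N j i + N i j * N j j) := by
      rw [← Finset.sum_filter_add_sum_filter_not Finset.univ (fun k => k ≠ i ∧ k ≠ j)]
      congr 1
      have : (Finset.univ.filter fun k => ¬ (k ≠ i ∧ k ≠ j)) = {i, j} := by
        ext k
        simp only [Finset.mem_filter, Finset.mem_univ, true_and, Finset.mem_insert,
          Finset.mem_singleton]
        tauto
      rw [this, Finset.sum_pair hij]
    rw [hcomp]
    have h1 := (h.codegree i j hij).le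
    have h2 := hbb i i j i
    have h4 := hbb i j j j
    refine (abs_add_le _ _).trans ?_
    have h5 := abs_add_le (N i i * N j i) (N i j * N j j)
    linarith
  · gcongr
    linarith

end Bounds

/-! ### Expansion of the normalized matrix around the spiked model -/

/-- The function `(x, y) ↦ (1 + x) ^ β * (1 + y) ^ γ` is Lipschitz at the origin. -/
lemma exists_abs_one_add_rpow_mul_sub_one_le (β γ : ℝ) :
    ∃ C > 0, ∃ η > 0, ∀ t ≤ η, ∀ x y : ℝ, |x| ≤ t → |y| ≤ t →
      |(1 + x) ^ β * (1 + y) ^ γ - 1| ≤ C * t := by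
  have hd : DifferentiableAt ℝ (fun z : ℝ × ℝ => (1 + z.1) ^ β * (1 + z.2) ^ γ) 0 := by
    refine DifferentiableAt.mul ?_ ?_
    · exact (differentiableAt_fst.const_add 1).rpow_const (Or.inl (by simp))
    · exact (differentiableAt_snd.const_add 1).rpow_const (Or.inl (by simp))
  obtain ⟨C, hC, hO⟩ := hd.isBigO_sub.exists_pos
  obtain ⟨η, hη, hball⟩ := Metric.eventually_nhds_iff.1 hO.bound
  refine ⟨C, hC, η / 2, by positivity, fun t ht x y hx hy => ?_⟩
  have hz : ‖((x, y) : ℝ × ℝ)‖ ≤ t := by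
    rw [Prod.norm_def]; exact max_le hx hy
  have := hball (y := (x, y)) (by rw [dist_zero_right]; linarith)
  simp only [Prod.fst_zero, add_zero, Real.one_rpow, Prod.snd_zero, mul_one, sub_zero,
    Real.norm_eq_abs] at this
  exact this.trans (by gcongr)

lemma abs_one_add_mul_div_sub_le {t x y e : ℝ} (ht : t ≤ 1 / 2) (hx : |x| ≤ t) (hy : |y| ≤ t)
    (he : |e| ≤ t) : |(1 + x) * (1 + y) / (1 + e) - (1 + x + y - e)| ≤ 8 * t ^ 2 := by
  have he' := abs_le.1 he
  have hpos : 1 / 2 ≤ 1 + e := by linarith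
  have key : (1 + x) * (1 + y) / (1 + e) - (1 + x + y - e) = (x - e) * (y - e) / (1 + e) := by
    field_simp
    ring
  have ht0 : 0 ≤ t := (abs_nonneg x).trans hx
  have h1 : |x - e| ≤ 2 * t := (abs_sub _ _).trans (by linarith)
  have h2 : |y - e| ≤ 2 * t := (abs_sub _ _).trans (by linarith)
  rw [key, abs_div, abs_mul, abs_of_pos (by linarith : 0 < 1 + e),
    div_le_iff₀ (by linarith : 0 < 1 + e)]
  calc |x - e| * |y - e| ≤ 2 * t * (2 * t) := by gcongr
    _ = 8 * t ^ 2 * (1 / 2) := by ring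
    _ ≤ 8 * t ^ 2 * (1 + e) := by gcongr

/-- The modularity matrix in terms of the relative deviations of the degrees: all powers of the
total weight cancel. -/
lemma modularity_apply_eq {n K : ℕ} (α : ℝ) (g : Fin n → Fin K) (M : Matrix (Fin K) (Fin K) ℝ)
    {q : Fin n → ℝ} (hq : ∀ i, 0 < q i) (A : Matrix (Fin n) (Fin n) ℝ)
    {δ : Fin n → ℝ} (hδ : δ = degreeDev g M q (noise g M q A))
    {e : ℝ} (he : e = totalDev g M q (noise g M q A))
    (hδ1 : ∀ i, 0 < 1 + δ i) (he1 : 0 < 1 + e) (i j : Fin n) :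
    modularity α A i j = (√(n : ℝ))⁻¹ *
      ((q i ^ (-α) * ((1 + e) ^ (α / 2) * (1 + δ i) ^ (-α))) *
        (q j ^ (-α) * ((1 + e) ^ (α / 2) * (1 + δ j) ^ (-α))) * (noise g M q A i j +
          q i * q j * (1 + (√(n : ℝ))⁻¹ * M (g i) (g j) -
            (1 + δ i) * (1 + δ j) / (1 + e)))) := by
  have hQ : 0 < ∑ k, q k := Finset.sum_pos (fun k _ => hq k) ⟨i, Finset.mem_univ i⟩
  have hdeg : ∀ i, (A *ᵥ 1) i = q i * (∑ j, q j) * (1 + δ i) := fun i => by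
    rw [hδ]; exact degree_eq g M A hQ.ne' (hq i).ne'
  have htot : (A *ᵥ 1) ⬝ᵥ 1 = (∑ j, q j) ^ 2 * (1 + e) := by
    rw [he]; exact total_eq g M A hQ.ne'
  rw [modularity_apply, hdeg, hdeg, htot]
  set Q := ∑ j, q j
  have hA : A i j = noise g M q A i j + q i * q j * (1 + (√(n : ℝ))⁻¹ * M (g i) (g j)) := by
    simp only [noise, Matrix.of_apply]; ring
  have hdpow : ∀ i, (q i * Q * (1 + δ i)) ^ (-α) = q i ^ (-α) * Q ^ (-α) * (1 + δ i) ^ (-α) :=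
    fun i => by
      rw [Real.mul_rpow (mul_nonneg (hq i).le hQ.le) (hδ1 i).le, Real.mul_rpow (hq i).le hQ.le]
  have htpow : (Q ^ 2 * (1 + e)) ^ α * (Q ^ (-α) * Q ^ (-α)) =
      (1 + e) ^ (α / 2) * (1 + e) ^ (α / 2) := by
    rw [Real.mul_rpow (by positivity) he1.le, ← Real.rpow_add he1, ← Real.rpow_add hQ,
      ← Real.rpow_natCast Q 2, ← Real.rpow_mul hQ.le]
    have : Q ^ (((2 : ℕ) : ℝ) * α) * Q ^ (-α + -α) = 1 := by
      rw [← Real.rpow_add hQ]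
      have : ((2 : ℕ) : ℝ) * α + (-α + -α) = 0 := by push_cast; ring
      rw [this, Real.rpow_zero]
    rw [mul_right_comm, this, one_mul]
    congr 1
    ring
  have hfrac : q i * Q * (1 + δ i) * (q j * Q * (1 + δ j)) / (Q ^ 2 * (1 + e)) =
      q i * q j * ((1 + δ i) * (1 + δ j) / (1 + e)) := by
    field_simp
  rw [hdpow, hdpow, hfrac]
  rw [show A i j - q i * q j * ((1 + δ i) * (1 + δ j) / (1 + e)) = noise g M q A i j +
    q i * q j * (1 + (√(n : ℝ))⁻¹ * M (g i) (g j) - (1 + δ i) * (1 + δ j) / (1 + e)) by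
      rw [hA]; simp only [noise, Matrix.of_apply]; ring]
  generalize noise g M q A i j + q i * q j * (1 + (√(n : ℝ))⁻¹ * M (g i) (g j) -
    (1 + δ i) * (1 + δ j) / (1 + e)) = W
  linear_combination (√(n : ℝ))⁻¹ * q i ^ (-α) * q j ^ (-α) * (1 + δ i) ^ (-α) *
    (1 + δ j) ^ (-α) * W * htpow

section Comparison

variable {n K : ℕ} {a m B : ℝ} {g : Fin n → Fin K} {M : Matrix (Fin K) (Fin K) ℝ}
  {q : Fin n → ℝ} {H : SimpleGraph (Fin n)}

lemma abs_dotProduct_le_mul_sum_abs {f v : Fin K → ℝ} (hf : ∀ k, |f k| ≤ B) :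
    |f ⬝ᵥ v| ≤ B * ∑ k, |v k| := by
  rw [dotProduct, Finset.mul_sum]
  refine (Finset.abs_sum_le_sum_abs _ _).trans (Finset.sum_le_sum fun k _ => ?_)
  rw [abs_mul]
  exact mul_le_mul_of_nonneg_right (hf k) (abs_nonneg _)

lemma abs_mulVec_le_of_sum_abs_le_one (hB : 0 ≤ B) (hM : ∀ k l, |M k l| ≤ B) {v : Fin K → ℝ}
    (hv : ∑ k, |v k| ≤ 1) (k : Fin K) : |(M *ᵥ v) k| ≤ B :=
  (abs_dotProduct_le_mul_sum_abs (hM k)).trans (mul_le_of_le_one_right hB hv)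

/-- Replacing the class shares by their limits `c` in the coefficients of the expansion. -/
lemma abs_class_coefficient_sub_le (hB : 0 ≤ B) (hM : ∀ k l, |M k l| ≤ B) {w c : Fin K → ℝ}
    (hw : ∑ k, |w k| ≤ 1) (hc : ∑ k, |c k| ≤ 1) (k l : Fin K) :
    |((M *ᵥ c) k - (M *ᵥ w) k) + ((M *ᵥ c) l - (M *ᵥ w) l) +
      (w ⬝ᵥ (M *ᵥ w) - c ⬝ᵥ (M *ᵥ c))| ≤ 4 * B * ∑ k, |w k - c k| := by
  set S := ∑ k, |w k - c k| with hS
  have hS0 : 0 ≤ S := Finset.sum_nonneg fun _ _ => abs_nonneg _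
  have hdiff : ∀ k, |(M *ᵥ (w - c)) k| ≤ B * S := fun k => abs_dotProduct_le_mul_sum_abs (hM k)
  have h1 : ∀ k, |(M *ᵥ c) k - (M *ᵥ w) k| ≤ B * S := fun k => by
    have := hdiff k
    rwa [Matrix.mulVec_sub, Pi.sub_apply, abs_sub_comm] at this
  have h2 : |w ⬝ᵥ (M *ᵥ w) - c ⬝ᵥ (M *ᵥ c)| ≤ 2 * (B * S) := by
    have e : w ⬝ᵥ (M *ᵥ w) - c ⬝ᵥ (M *ᵥ c) =
        (M *ᵥ (w - c)) ⬝ᵥ w + (M *ᵥ c) ⬝ᵥ (w - c) := by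
      rw [Matrix.mulVec_sub, sub_dotProduct, dotProduct_sub, dotProduct_comm (M *ᵥ w),
        dotProduct_comm (M *ᵥ c) c]
      ring
    have h3 := abs_dotProduct_le_mul_sum_abs (v := w) hdiff
    have h4 := abs_dotProduct_le_mul_sum_abs (v := w - c)
      (abs_mulVec_le_of_sum_abs_le_one hB hM hc)
    have h5 : B * S * ∑ k, |w k| ≤ B * S := mul_le_of_le_one_right (by positivity) hw
    rw [e]
    refine (abs_add_le _ _).trans ?_
    simp only [Pi.sub_apply] at h4
    linarith
  have ha := abs_add_le ((M *ᵥ c) k - (M *ᵥ w) k) ((M *ᵥ c) l - (M *ᵥ w) l)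
  refine (abs_add_le _ _).trans ?_
  linarith [h1 k, h1 l]

lemma sum_abs_classShare_le_one (ha : 0 < a) (hq : ∀ i, q i ∈ Set.Icc a 1)
    (hQ : ∑ i, q i ≠ 0) : ∑ k, |classShare g q k| ≤ 1 := by
  rw [← sum_classShare g hQ]
  exact (Finset.sum_congr rfl fun k _ =>
    abs_of_nonneg (classShare_nonneg g (fun i => ha.le.trans (hq i).1) k)).le

lemma mul_le_sum_weight (hq : ∀ i, q i ∈ Set.Icc a 1) : a * n ≤ ∑ i, q i := by
  have := Finset.sum_le_sum fun i (_ : i ∈ Finset.univ) => (hq i).1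
  simpa [mul_comm] using this

lemma Concentrated.abs_degreeDev_le (h : Concentrated a m g M q (adjacency H))
    (ha : 0 < a) (hB0 : 0 ≤ B) (hM : ∀ k l, |M k l| ≤ B) (hB : B ≤ √(n : ℝ)) (hn : 3 ≤ √(n : ℝ))
    (hL : 1 ≤ √(8 * Real.log n)) (i : Fin n) :
    |degreeDev g M q (noise g M q (adjacency H)) i| ≤
      (B + 5 / a ^ 2) * ((√(n : ℝ))⁻¹ * √(8 * Real.log n)) := by
  have hx := h.abs_noise_mulVec_one_le ha hM hB hn hL i
  have hQn := mul_le_sum_weight h.weight_mem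
  set r := √(n : ℝ) with hr
  set L := √(8 * Real.log n)
  have hr0 : 0 < r := by linarith
  have hnr : (n : ℝ) = r ^ 2 := (Real.sq_sqrt (Nat.cast_nonneg n)).symm
  set Q := ∑ j, q j
  have hQ : 0 < Q := lt_of_lt_of_le (by rw [hnr]; positivity) hQn
  have hqQ : a ^ 2 * r ^ 2 ≤ q i * Q := by
    calc a ^ 2 * r ^ 2 = a * (a * n) := by rw [hnr]; ring
      _ ≤ q i * Q := mul_le_mul (h.weight_mem i).1 hQn (by positivity)
        (ha.le.trans (h.weight_mem i).1)
  have hw := abs_mulVec_le_of_sum_abs_le_one hB0 hM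
    (sum_abs_classShare_le_one (g := g) ha h.weight_mem hQ.ne') (g i)
  have hqQ0 : 0 < q i * Q := lt_of_lt_of_le (by positivity) hqQ
  have h1 : |r⁻¹ * (M *ᵥ classShare g q) (g i)| ≤ B * (r⁻¹ * L) := by
    rw [abs_mul, abs_of_pos (by positivity)]
    calc _ ≤ r⁻¹ * B := by gcongr
      _ ≤ r⁻¹ * B * L := le_mul_of_one_le_right (by positivity) hL
      _ = _ := by ring
  have h2 : |(noise g M q (adjacency H) *ᵥ 1) i / (q i * Q)| ≤ 5 / a ^ 2 * (r⁻¹ * L) := by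
    rw [abs_div, abs_of_pos hqQ0]
    calc _ ≤ 2 * (r * L) / (a ^ 2 * r ^ 2) := by gcongr
      _ = 2 / a ^ 2 * (r⁻¹ * L) := by field_simp
      _ ≤ _ := by gcongr; norm_num
  exact (abs_add_le _ _).trans (by linarith)

lemma Concentrated.abs_noise_total_div_le (h : Concentrated a m g M q (adjacency H))
    (hC : (classWeights n M).IsSymm)
    (ha : 0 < a) (hM : ∀ k l, |M k l| ≤ B) (hB : B ≤ √(n : ℝ)) (hn : 3 ≤ √(n : ℝ))
    (hL : 1 ≤ √(8 * Real.log n)) :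
    |((noise g M q (adjacency H) *ᵥ 1) ⬝ᵥ 1) / (∑ j, q j) ^ 2| ≤
      5 / a ^ 2 * ((√(n : ℝ))⁻¹ * ((√(n : ℝ))⁻¹ * √(8 * Real.log n))) := by
  have hx := h.abs_noise_total_le hC ha hM hB hL
  have hQn := mul_le_sum_weight h.weight_mem
  have hr0 : 0 < √(n : ℝ) := by linarith
  have hnr : (n : ℝ) = √(n : ℝ) ^ 2 := (Real.sq_sqrt (Nat.cast_nonneg n)).symm
  have hn0 : (0 : ℝ) < n := by rw [hnr]; positivity
  have hQ : 0 < ∑ j, q j := lt_of_lt_of_le (by positivity) hQn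
  rw [abs_div, abs_of_pos (by positivity : 0 < (∑ j, q j) ^ 2)]
  calc _ ≤ 5 * (n * √(8 * Real.log n)) / (a * n) ^ 2 := by gcongr
    _ = 5 / a ^ 2 * ((n : ℝ)⁻¹ * √(8 * Real.log n)) := by field_simp
    _ = _ := by
      rw [← mul_assoc (√(n : ℝ))⁻¹, ← mul_inv, ← sq, ← hnr]

lemma Concentrated.abs_totalDev_le (h : Concentrated a m g M q (adjacency H))
    (hC : (classWeights n M).IsSymm)
    (ha : 0 < a) (hB0 : 0 ≤ B) (hM : ∀ k l, |M k l| ≤ B) (hB : B ≤ √(n : ℝ)) (hn : 3 ≤ √(n : ℝ))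
    (hL : 1 ≤ √(8 * Real.log n)) :
    |totalDev g M q (noise g M q (adjacency H))| ≤
      (B + 5 / a ^ 2) * ((√(n : ℝ))⁻¹ * √(8 * Real.log n)) := by
  have hx := h.abs_noise_total_div_le hC ha hM hB hn hL
  have hQn := mul_le_sum_weight h.weight_mem
  have hr0 : 0 < √(n : ℝ) := by linarith
  have hn0 : (0 : ℝ) < n := Real.sqrt_pos.1 hr0
  have hQ : 0 < ∑ j, q j := lt_of_lt_of_le (by positivity) hQn
  have hs1 : (√(n : ℝ))⁻¹ ≤ 1 := inv_le_one_of_one_le₀ (by linarith)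
  have hsum := sum_abs_classShare_le_one (g := g) ha h.weight_mem hQ.ne'
  have hw : |classShare g q ⬝ᵥ (M *ᵥ classShare g q)| ≤ B := by
    rw [dotProduct_comm]
    exact (abs_dotProduct_le_mul_sum_abs (abs_mulVec_le_of_sum_abs_le_one hB0 hM hsum)).trans
      (mul_le_of_le_one_right hB0 hsum)
  have h1 : |(√(n : ℝ))⁻¹ * (classShare g q ⬝ᵥ (M *ᵥ classShare g q))| ≤
      B * ((√(n : ℝ))⁻¹ * √(8 * Real.log n)) := by
    rw [abs_mul, abs_of_pos (by positivity)]
    calc _ ≤ (√(n : ℝ))⁻¹ * B := by gcongr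
      _ ≤ (√(n : ℝ))⁻¹ * B * √(8 * Real.log n) := le_mul_of_one_le_right (by positivity) hL
      _ = _ := by ring
  have h2 : 5 / a ^ 2 * ((√(n : ℝ))⁻¹ * ((√(n : ℝ))⁻¹ * √(8 * Real.log n))) ≤
      5 / a ^ 2 * ((√(n : ℝ))⁻¹ * √(8 * Real.log n)) := by
    gcongr
    exact mul_le_of_le_one_left (by positivity) hs1
  exact (abs_add_le _ _).trans (by linarith)

/-- Comparison of the two matrices for a fixed number of nodes. Here `τ = √(8 log n) / √n` is the
order of the relative deviations of the degrees. The terms on the right-hand side come, in this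
order, from the noise matrix, from the powers of the degrees, from the second order terms of the
expansion, from the class shares that are replaced by their limits, and from the total noise. -/
lemma Concentrated.opNorm_modularity_sub_spikedModel_le
    (h : Concentrated a m g M q (adjacency H)) (hC : (classWeights n M).IsSymm)
    (ha : 0 < a) (hB0 : 0 ≤ B) (hM : ∀ k l, |M k l| ≤ B) (hB : B ≤ √(n : ℝ)) (hn : 3 ≤ √(n : ℝ))
    (hL : 1 ≤ √(8 * Real.log n)) {c : Fin K → ℝ} (hc : ∑ k, |c k| ≤ 1)
    {α C D τ b : ℝ} (hC0 : 0 < C) (hD : D = B + 5 / a ^ 2)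
    (hτ : τ = (√(n : ℝ))⁻¹ * √(8 * Real.log n))
    (hDτ : D * τ ≤ 1 / 2) (hCτ : C * τ ≤ 1) (hb : ∀ i, |q i ^ (-α)| ≤ b)
    (hpow : ∀ x y : ℝ, |x| ≤ D * τ → |y| ≤ D * τ →
      |(1 + x) ^ (α / 2) * (1 + y) ^ (-α) - 1| ≤ C * τ) :
    opNorm (modularity α (adjacency H) -
        spikedModel α g M c q (noise g M q (adjacency H))) ≤
      4 * b ^ 2 * C * √(10 * (√(8 * Real.log n) ^ 2 * τ)) +
      b ^ 2 * (24 * C * D * (√(8 * Real.log n) * τ) + 8 * D ^ 2 * (√(8 * Real.log n) * τ) +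
        (4 * B * ∑ k, |classShare g q k - c k| + 5 / a ^ 2 * τ)) := by
  have hnoise := h.opNorm_noise_sq_le ha hM hB hn hL
  have hδb := h.abs_degreeDev_le ha hB0 hM hB hn hL
  have heb := h.abs_totalDev_le hC ha hB0 hM hB hn hL
  have hTb := h.abs_noise_total_div_le hC ha hM hB hn hL
  have hr0 : 0 < √(n : ℝ) := by linarith
  have hn0 : (0 : ℝ) < n := Real.sqrt_pos.1 hr0
  have hnr : (n : ℝ) = √(n : ℝ) ^ 2 := (Real.sq_sqrt hn0.le).symm
  have hMs : M.IsSymm := isSymm_of_classWeights hr0 hC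
  have hq : ∀ i, 0 < q i := fun i => lt_of_lt_of_le ha (h.weight_mem i).1
  have hQ : 0 < ∑ j, q j := lt_of_lt_of_le (by positivity) (mul_le_sum_weight h.weight_mem)
  set X := noise g M q (adjacency H) with hX
  set L := √(8 * Real.log n) with hLdef
  set s := (√(n : ℝ))⁻¹ with hs
  rw [← hτ, ← hD] at hδb heb
  rw [← hτ] at hTb
  obtain ⟨δ, hδ⟩ : ∃ δ, δ = degreeDev g M q X := ⟨_, rfl⟩
  obtain ⟨e, he⟩ : ∃ e, e = totalDev g M q X := ⟨_, rfl⟩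
  rw [← he] at heb
  simp only [← hδ] at hδb
  have hs0 : 0 < s := by positivity
  have hτ0 : 0 < τ := by rw [hτ]; positivity
  have hsτ : s ≤ τ := by rw [hτ]; exact le_mul_of_one_le_right hs0.le hL
  have hD0 : 0 < D := by rw [hD]; positivity
  have hBD : B ≤ D := by rw [hD]; linarith [show (0 : ℝ) < 5 / a ^ 2 by positivity]
  obtain ⟨i₀⟩ : Nonempty (Fin n) := ⟨⟨0, by exact_mod_cast hn0⟩⟩
  have hb0 : 0 ≤ b := (abs_nonneg _).trans (hb i₀)
  have hδ1 : ∀ i, 0 < 1 + δ i := fun i => by linarith [(abs_le.1 (hδb i)).1]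
  have he1 : 0 < 1 + e := by linarith [(abs_le.1 heb).1]
  set r : Fin n → ℝ := fun i => q i ^ (-α) with hr
  set θ : Fin n → ℝ := fun i => (1 + e) ^ (α / 2) * (1 + δ i) ^ (-α) with hθ
  have hθ1 : ∀ i, |θ i - 1| ≤ C * τ := fun i => hpow _ _ heb (hδb i)
  have hθ2 : ∀ i, |θ i| ≤ 2 := fun i => by
    have := abs_le.1 (hθ1 i)
    rw [abs_le]; constructor <;> linarith
  have hθθ : ∀ i j, |θ i * θ j - 1| ≤ 3 * (C * τ) := fun i j => by
    have e1 : θ i * θ j - 1 = (θ i - 1) * θ j + (θ j - 1) := by ring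
    rw [e1]
    refine (abs_add_le _ _).trans ?_
    rw [abs_mul]
    have := mul_le_mul (hθ1 i) (hθ2 j) (abs_nonneg _) (by positivity)
    linarith [hθ1 j]
  set κ := 4 * B * ∑ k, |classShare g q k - c k| with hκ
  have hκ0 : 0 ≤ κ := mul_nonneg (by positivity) (Finset.sum_nonneg fun _ _ => abs_nonneg _)
  -- `R` and `R'` are the coefficients of the deterministic parts of the two matrices.
  let R : Fin n → Fin n → ℝ := fun i j =>
    1 + s * M (g i) (g j) - (1 + δ i) * (1 + δ j) / (1 + e)
  let R' : Fin n → Fin n → ℝ := fun i j =>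
    s * (M (g i) (g j) - (M *ᵥ c) (g i) - (M *ᵥ c) (g j) + c ⬝ᵥ (M *ᵥ c)) -
      (X *ᵥ 1) i / (q i * ∑ k, q k) - (X *ᵥ 1) j / (q j * ∑ k, q k)
  have hRR : ∀ i j, |R i j - R' i j| ≤ s * (κ + 5 / a ^ 2 * τ) + 8 * (D * τ) ^ 2 := fun i j => by
    have h1 := abs_one_add_mul_div_sub_le hDτ (hδb i) (hδb j) heb
    have h2 := abs_class_coefficient_sub_le hB0 hM
      (sum_abs_classShare_le_one (g := g) ha h.weight_mem hQ.ne') hc (g i) (g j)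
    have e1 : R i j - R' i j =
        s * (((M *ᵥ c) (g i) - (M *ᵥ classShare g q) (g i)) +
          ((M *ᵥ c) (g j) - (M *ᵥ classShare g q) (g j)) +
          (classShare g q ⬝ᵥ (M *ᵥ classShare g q) - c ⬝ᵥ (M *ᵥ c))) +
        ((X *ᵥ 1) ⬝ᵥ 1) / (∑ j, q j) ^ 2 -
        ((1 + δ i) * (1 + δ j) / (1 + e) - (1 + δ i + δ j - e)) := by
      simp only [R, R']
      rw [show e = s * (classShare g q ⬝ᵥ (M *ᵥ classShare g q)) +
          ((X *ᵥ 1) ⬝ᵥ 1) / (∑ j, q j) ^ 2 from he,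
        show δ i = s * (M *ᵥ classShare g q) (g i) + (X *ᵥ 1) i / (q i * ∑ j, q j) by
          rw [hδ]; rfl,
        show δ j = s * (M *ᵥ classShare g q) (g j) + (X *ᵥ 1) j / (q j * ∑ j, q j) by
          rw [hδ]; rfl]
      ring
    rw [e1]
    refine (abs_sub _ _).trans ?_
    refine (add_le_add (abs_add_le _ _) le_rfl).trans ?_
    rw [abs_mul, abs_of_pos hs0]
    have h3 := mul_le_mul_of_nonneg_left h2 hs0.le
    linarith
  have hRb : ∀ i j, |R i j| ≤ 8 * (D * τ) := fun i j => by
    have h1 := abs_one_add_mul_div_sub_le hDτ (hδb i) (hδb j) heb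
    have e1 : R i j = s * M (g i) (g j) - δ i - δ j + e -
        ((1 + δ i) * (1 + δ j) / (1 + e) - (1 + δ i + δ j - e)) := by
      simp only [R]; ring
    have h2 : |s * M (g i) (g j)| ≤ D * τ := by
      rw [abs_mul, abs_of_pos hs0, mul_comm D]
      exact mul_le_mul hsτ ((hM _ _).trans hBD) (abs_nonneg _) hτ0.le
    have h3 : 8 * (D * τ) ^ 2 ≤ 4 * (D * τ) := by
      have : 0 ≤ D * τ := by positivity
      nlinarith
    have hi := abs_le.1 (hδb i)
    have hj := abs_le.1 (hδb j)
    have he' := abs_le.1 heb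
    have h1' := abs_le.1 h1
    have h2' := abs_le.1 h2
    rw [e1, abs_le]
    constructor <;> linarith
  let E : Matrix (Fin n) (Fin n) ℝ := Matrix.of fun i j =>
    r i * r j * (q i * q j) * (θ i * θ j * R i j - R' i j)
  have hsplit : modularity α (adjacency H) - spikedModel α g M c q X =
      s • ((Matrix.diagonal (fun i => r i * θ i) * X * Matrix.diagonal (fun i => r i * θ i) -
        Matrix.diagonal r * X * Matrix.diagonal r) + E) := by
    ext i j
    rw [Matrix.sub_apply, modularity_apply_eq α g M hq (adjacency H) hδ he hδ1 he1,
      spikedModel_apply α g hMs c hq]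
    simp only [Matrix.smul_apply, Matrix.add_apply, Matrix.sub_apply, Matrix.mul_diagonal,
      Matrix.diagonal_mul, Matrix.of_apply, smul_eq_mul, E, R, R', hr, hθ]
    ring
  have hEb : ∀ i j, |E i j| ≤ b ^ 2 * (24 * C * D * τ ^ 2 +
      (s * (κ + 5 / a ^ 2 * τ) + 8 * D ^ 2 * τ ^ 2)) := fun i j => by
    have h1 : |r i * r j * (q i * q j)| ≤ b ^ 2 := by
      rw [abs_mul, abs_mul, sq]
      refine (mul_le_of_le_one_right (by positivity) ?_).trans
        (mul_le_mul (hb i) (hb j) (abs_nonneg _) hb0)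
      rw [abs_of_pos (mul_pos (hq i) (hq j))]
      exact mul_le_one₀ (h.weight_mem i).2 (hq j).le (h.weight_mem j).2
    have h2 : |θ i * θ j * R i j - R' i j| ≤ 24 * C * D * τ ^ 2 +
        (s * (κ + 5 / a ^ 2 * τ) + 8 * D ^ 2 * τ ^ 2) := by
      have e1 : θ i * θ j * R i j - R' i j = (θ i * θ j - 1) * R i j + (R i j - R' i j) := by ring
      rw [e1]
      refine (abs_add_le _ _).trans ?_
      rw [abs_mul]
      have h3 := mul_le_mul (hθθ i j) (hRb i j) (abs_nonneg _) (by positivity)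
      have h4 := hRR i j
      linarith
    simp only [E, Matrix.of_apply]
    rw [abs_mul]
    exact mul_le_mul h1 h2 (abs_nonneg _) (by positivity)
  have hconj := opNorm_diagonal_conj_sub_le X (ρ := fun i => r i * θ i) (r := r) (b := 2 * b)
    (ε := b * (C * τ)) (by positivity) (by positivity)
    (fun i => by
      rw [abs_mul, mul_comm]
      exact mul_le_mul (hθ2 i) (hb i) (abs_nonneg _) (by norm_num))
    (fun i => (hb i).trans (by linarith))
    (fun i => by
      rw [show r i * θ i - r i = r i * (θ i - 1) by ring, abs_mul]
      exact mul_le_mul (hb i) (hθ1 i) (abs_nonneg _) hb0)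
  have hXnorm : s * τ * opNorm X ≤ √(10 * (L ^ 2 * τ)) := by
    refine Real.le_sqrt_of_sq_le ?_
    rw [mul_pow]
    calc (s * τ) ^ 2 * opNorm X ^ 2 ≤ (s * τ) ^ 2 * (n * (10 * (√(n : ℝ) * L))) := by gcongr
      _ = 10 * (L ^ 2 * τ) := by
        rw [hτ, hs]
        generalize √(n : ℝ) = y at hr0 hnr ⊢
        rw [hnr]
        field_simp
  have hns : n * s = √(n : ℝ) := by
    rw [hs, ← div_eq_mul_inv]
    exact Real.div_sqrt
  have hsn : √(n : ℝ) * s = 1 := mul_inv_cancel₀ hr0.ne'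
  have hnτ : √(n : ℝ) * τ = L := by rw [hτ, ← mul_assoc, hsn, one_mul]
  rw [hsplit, opNorm_smul, abs_of_pos hs0]
  calc _ ≤ s * (2 * (2 * b) * (b * (C * τ)) * opNorm X + n * (b ^ 2 * (24 * C * D * τ ^ 2 +
        (s * (κ + 5 / a ^ 2 * τ) + 8 * D ^ 2 * τ ^ 2)))) := by
        gcongr
        exact (opNorm_add_le _ _).trans
          (add_le_add hconj (opNorm_le_of_forall_abs_le (by positivity) hEb))
    _ = 4 * b ^ 2 * C * (s * τ * opNorm X) + b ^ 2 * (24 * C * D * (√(n : ℝ) * τ * τ) +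
        (√(n : ℝ) * s * (κ + 5 / a ^ 2 * τ) + 8 * D ^ 2 * (√(n : ℝ) * τ * τ))) := by
        rw [← hns]; ring
    _ ≤ 4 * b ^ 2 * C * √(10 * (L ^ 2 * τ)) + b ^ 2 * (24 * C * D * (√(n : ℝ) * τ * τ) +
        (√(n : ℝ) * s * (κ + 5 / a ^ 2 * τ) + 8 * D ^ 2 * (√(n : ℝ) * τ * τ))) := by
        gcongr
    _ = _ := by rw [hsn, hnτ]; ring

lemma Concentrated.degree_pos (h : Concentrated a m g M q (adjacency H))
    (ha : 0 < a) (hB0 : 0 ≤ B) (hM : ∀ k l, |M k l| ≤ B) (hB : B ≤ √(n : ℝ)) (hn : 3 ≤ √(n : ℝ))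
    (hL : 1 ≤ √(8 * Real.log n))
    (hτ : (B + 5 / a ^ 2) * ((√(n : ℝ))⁻¹ * √(8 * Real.log n)) ≤ 1 / 2) (i : Fin n) :
    0 < (adjacency H *ᵥ 1) i := by
  have hδ := abs_le.1 (h.abs_degreeDev_le ha hB0 hM hB hn hL i)
  have hqi : 0 < q i := lt_of_lt_of_le ha (h.weight_mem i).1
  have hn0 : (0 : ℝ) < n := Real.sqrt_pos.1 (by linarith)
  have hQ : 0 < ∑ j, q j := lt_of_lt_of_le (by positivity) (mul_le_sum_weight h.weight_mem)
  rw [degree_eq g M (adjacency H) hQ.ne' hqi.ne']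
  have : 0 < 1 + degreeDev g M q (noise g M q (adjacency H)) i := by linarith [hδ.1]
  positivity

end Comparison

/-! ### Passage to the limit -/

lemma tendsto_sqrt_log_sq_mul_inv_sqrt :
    Tendsto (fun n : ℕ => √(8 * Real.log n) ^ 2 * ((√(n : ℝ))⁻¹ * √(8 * Real.log n)))
      atTop (𝓝 0) := by
  have h1 : Tendsto (fun n : ℕ => Real.log (n : ℝ) ^ 3 / (n : ℝ)) atTop (𝓝 0) :=
    (Real.isLittleO_pow_log_id_atTop (n := 3)).tendsto_div_nhds_zero.comp
      tendsto_natCast_atTop_atTop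
  have h2 : Tendsto (fun n : ℕ => √(512 * (Real.log (n : ℝ) ^ 3 / (n : ℝ)))) atTop (𝓝 0) := by
    simpa using (h1.const_mul 512).sqrt
  refine h2.congr' ?_
  filter_upwards [eventually_ge_atTop 1] with n hn
  have hlog : 0 ≤ Real.log n := Real.log_nonneg (by exact_mod_cast hn)
  have hL : √(8 * Real.log n) ^ 2 = 8 * Real.log n := Real.sq_sqrt (by positivity)
  have hs : √(n : ℝ) ^ 2 = n := Real.sq_sqrt (by positivity)
  have e : 512 * (Real.log n ^ 3 / n) =
      (√(8 * Real.log n) ^ 2 * ((√(n : ℝ))⁻¹ * √(8 * Real.log n))) ^ 2 := by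
    rw [mul_pow, mul_pow, inv_pow, hs, hL]
    ring
  rw [e, Real.sqrt_sq (by positivity)]

lemma tendsto_sqrt_log_atTop : Tendsto (fun n : ℕ => √(8 * Real.log n)) atTop atTop :=
  Real.tendsto_sqrt_atTop.comp ((Real.tendsto_log_atTop.comp
    tendsto_natCast_atTop_atTop).const_mul_atTop (by norm_num))

lemma sum_eq_one_of_tendsto_class_sizes {K : ℕ} {g : ∀ n : ℕ, Fin n → Fin K} {c : Fin K → ℝ}
    (hc : ∀ k, Tendsto (fun n : ℕ => ((Finset.univ.filter fun i => g n i = k).card : ℝ) / n)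
      atTop (𝓝 (c k))) : ∑ k, c k = 1 := by
  refine tendsto_nhds_unique (tendsto_finsetSum Finset.univ fun k _ => hc k) ?_
  refine tendsto_const_nhds.congr' ?_
  filter_upwards [eventually_ge_atTop 1] with n hn
  have h := Finset.card_eq_sum_card_fiberwise (f := g n) (s := Finset.univ) (t := Finset.univ)
    (fun _ _ => Finset.mem_coe.2 (Finset.mem_univ _))
  rw [Finset.card_univ, Fintype.card_fin] at h
  have hn' : (n : ℝ) ≠ 0 := by positivity
  rw [← Finset.sum_div, ← Nat.cast_sum, ← h, div_self hn']

/-- The class shares of the weights converge to the limiting class sizes, because the law of the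
weights does not depend on the class. -/
lemma tendsto_classShare {K : ℕ} {a m : ℝ} {g : ∀ n : ℕ, Fin n → Fin K}
    {M : ℕ → Matrix (Fin K) (Fin K) ℝ} {c : Fin K → ℝ}
    (hc : ∀ k, Tendsto (fun n : ℕ => ((Finset.univ.filter fun i => g n i = k).card : ℝ) / n)
      atTop (𝓝 (c k)))
    {q : ∀ n : ℕ, Fin n → ℝ} {A : ∀ n : ℕ, Matrix (Fin n) (Fin n) ℝ} (hm : m ≠ 0)
    (hconc : ∀ᶠ n in atTop, Concentrated a m (g n) (M n) (q n) (A n))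
    (hτ : Tendsto (fun n : ℕ => (√(n : ℝ))⁻¹ * √(8 * Real.log n)) atTop (𝓝 0)) (k : Fin K) :
    Tendsto (fun n => classShare (g n) (q n) k) atTop (𝓝 (c k)) := by
  have hcsum := sum_eq_one_of_tendsto_class_sizes hc
  have hS : ∀ k, Tendsto (fun n : ℕ =>
      (∑ i ∈ Finset.univ.filter fun i => g n i = k, q n i) / (n : ℝ)) atTop (𝓝 (c k * m)) := by
    intro k
    have h1 := (hc k).mul_const m
    have h2 : Tendsto (fun n : ℕ => (∑ i ∈ Finset.univ.filter fun i => g n i = k, (q n i - m)) /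
        (n : ℝ)) atTop (𝓝 0) := by
      refine squeeze_zero_norm' ?_ hτ
      filter_upwards [hconc] with n hn
      rw [Real.norm_eq_abs, abs_div, Nat.abs_cast]
      calc _ ≤ √(n : ℝ) * √(8 * Real.log n) / n := by gcongr; exact (hn.classSum k).le
        _ = √(8 * Real.log n) * (√(n : ℝ) / n) := by ring
        _ = _ := by rw [Real.sqrt_div_self', one_div, mul_comm]
    have h3 := h1.add h2
    rw [add_zero] at h3
    refine h3.congr fun n => ?_
    rw [Finset.sum_sub_distrib, Finset.sum_const, nsmul_eq_mul]
    ring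
  have hQ : Tendsto (fun n : ℕ => (∑ i, q n i) / (n : ℝ)) atTop (𝓝 m) := by
    have h := tendsto_finsetSum Finset.univ fun k _ => hS k
    rw [← Finset.sum_mul, hcsum, one_mul] at h
    refine h.congr fun n => ?_
    rw [← Finset.sum_div, Finset.sum_fiberwise Finset.univ (g n) (q n)]
  have h := (hS k).div hQ hm
  rw [mul_div_cancel_right₀ _ hm] at h
  refine h.congr' ?_
  filter_upwards [eventually_ge_atTop 1] with n hn
  have hn' : (n : ℝ) ≠ 0 := by positivity
  exact div_div_div_cancel_right₀ hn' _ _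

lemma abs_rpow_le_one_add_rpow {a x : ℝ} (ha : 0 < a) (hx : x ∈ Set.Icc a 1) (β : ℝ) :
    |x ^ β| ≤ 1 + a ^ β := by
  have hx0 : 0 < x := ha.trans_le hx.1
  rw [abs_of_pos (Real.rpow_pos_of_pos hx0 _)]
  have hpos := Real.rpow_pos_of_pos ha β
  rcases le_total 0 β with hβ | hβ
  · linarith [Real.rpow_le_one hx0.le hx.2 hβ]
  · linarith [Real.rpow_le_rpow_of_nonpos ha hx.1 hβ]

lemma exists_eventually_forall_abs_le {K : ℕ} {M : ℕ → Matrix (Fin K) (Fin K) ℝ}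
    (hM : ∀ a b, (fun n => M n a b) =O[atTop] (fun _ => (1 : ℝ))) :
    ∃ B, 0 ≤ B ∧ ∀ᶠ n in atTop, ∀ k l, |M n k l| ≤ B := by
  choose b hb using fun k l => (hM k l).bound
  refine ⟨∑ k, ∑ l, |b k l|, by positivity, ?_⟩
  have : ∀ᶠ n in atTop, ∀ k l, ‖M n k l‖ ≤ b k l * ‖(1 : ℝ)‖ :=
    eventually_all.2 fun k => eventually_all.2 fun l => hb k l
  filter_upwards [this] with n hn k l
  have h1 := hn k l
  rw [norm_one, mul_one, Real.norm_eq_abs] at h1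
  calc |M n k l| ≤ |b k l| := h1.trans (le_abs_self _)
    _ ≤ ∑ l, |b k l| := Finset.single_le_sum (f := fun l => |b k l|)
      (fun _ _ => abs_nonneg _) (Finset.mem_univ l)
    _ ≤ _ := Finset.single_le_sum (f := fun k => ∑ l, |b k l|)
      (fun _ _ => Finset.sum_nonneg fun _ _ => abs_nonneg _) (Finset.mem_univ k)

end DCSBM

end

theorem mainTheorem4 {Ω : Type*} [MeasurableSpace Ω] (P : Measure Ω) [IsProbabilityMeasure P]
    (μ : Measure ℝ) [IsProbabilityMeasure μ]
    (hμ_compact : IsCompact μ.support) (hμ_sub : μ.support ⊆ Set.Ioo (0 : ℝ) 1)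
    (K : ℕ)
    (g : ∀ n : ℕ, Fin n → Fin K)
    (M : ℕ → Matrix (Fin K) (Fin K) ℝ)
    (hM : ∀ a b, (fun n => M n a b) =O[atTop] (fun _ => (1 : ℝ)))
    (c : Fin K → ℝ) (hc_pos : ∀ k, 0 < c k)
    (hc : ∀ k, Tendsto (fun n : ℕ => ((Finset.univ.filter fun i => g n i = k).card : ℝ) / n)
      atTop (𝓝 (c k)))
    (q : ∀ n : ℕ, Fin n → Ω → ℝ)
    (G : ∀ n : ℕ, Ω → SimpleGraph (Fin n))
    (hG : ∀ᶠ n in atTop, DCSBM.IsDCSBM P μ (g n) (DCSBM.classWeights n (M n)) (q n) (G n))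
    (α : ℝ) :
    ∀ᵐ ω ∂P,
      (∀ᶠ n in atTop, ∀ i, 0 < (DCSBM.adjacency (G n ω) *ᵥ 1) i) ∧
      Tendsto
      (fun n : ℕ => DCSBM.opNorm
        (DCSBM.modularity α (DCSBM.adjacency (G n ω)) -
          DCSBM.spikedModel α (g n) (M n) c (fun i => q n i ω)
            (DCSBM.noise (g n) (M n) (fun i => q n i ω) (DCSBM.adjacency (G n ω)))))
      atTop (𝓝 0) := by
  open DCSBM in
  obtain ⟨a, ha, hμ⟩ := exists_pos_forall_mem_Icc_of_support hμ_compact hμ_sub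
  obtain ⟨B, hB0, hMB⟩ := exists_eventually_forall_abs_le hM
  have hm : ∫ x, x ∂μ ≠ 0 := by
    have h := integral_mono_ae (integrable_const a)
      (Integrable.of_mem_Icc a 1 aemeasurable_id hμ) (by
        filter_upwards [hμ] with x hx using hx.1)
    simp only [integral_const, probReal_univ, smul_eq_mul, one_mul, id] at h
    exact (ha.trans_le h).ne'
  have hcsum : ∑ k, |c k| ≤ 1 := by
    rw [← sum_eq_one_of_tendsto_class_sizes hc]
    exact (Finset.sum_congr rfl fun k _ => abs_of_pos (hc_pos k)).le
  have hL2τ := tendsto_sqrt_log_sq_mul_inv_sqrt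
  have hL1 : ∀ᶠ n : ℕ in atTop, 1 ≤ √(8 * Real.log n) :=
    tendsto_sqrt_log_atTop.eventually_ge_atTop 1
  have hLτ : Tendsto (fun n : ℕ => √(8 * Real.log n) * ((√(n : ℝ))⁻¹ * √(8 * Real.log n)))
      atTop (𝓝 0) := by
    refine squeeze_zero' (Eventually.of_forall fun n => by positivity) ?_ hL2τ
    filter_upwards [hL1] with n hn
    gcongr
    exact le_self_pow₀ hn two_ne_zero
  have hτ : Tendsto (fun n : ℕ => (√(n : ℝ))⁻¹ * √(8 * Real.log n)) atTop (𝓝 0) := by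
    refine squeeze_zero' (Eventually.of_forall fun n => by positivity) ?_ hLτ
    filter_upwards [hL1] with n hn
    exact le_mul_of_one_le_left (by positivity) hn
  have hsqrt : Tendsto (fun n : ℕ => √(n : ℝ)) atTop atTop :=
    Real.tendsto_sqrt_atTop.comp tendsto_natCast_atTop_atTop
  have hn3 := hsqrt.eventually_ge_atTop 3
  have hnB := hsqrt.eventually_ge_atTop B
  obtain ⟨C₀, hC₀, η, hη, hpow⟩ := exists_abs_one_add_rpow_mul_sub_one_le (α / 2) (-α)
  obtain ⟨D, hD⟩ : ∃ D, D = B + 5 / a ^ 2 := ⟨_, rfl⟩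
  have hD0 : 0 < D := by rw [hD]; positivity
  obtain ⟨C, hC⟩ : ∃ C, C = C₀ * D := ⟨_, rfl⟩
  have hC0 : 0 < C := by rw [hC]; positivity
  have hsmall : ∀ {t u : ℝ}, 0 < u →
      ∀ᶠ n : ℕ in atTop, t * ((√(n : ℝ))⁻¹ * √(8 * Real.log n)) ≤ u := fun {t u} hu => by
    have h := hτ.const_mul t
    rw [mul_zero] at h
    exact h.eventually (eventually_le_nhds hu)
  have hDη := hsmall (t := D) hη
  have hDhalf := hsmall (t := D) (u := 1 / 2) (by norm_num)
  have hCone := hsmall (t := C) (u := 1) (by norm_num)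
  filter_upwards [ae_eventually_concentrated hG ha hμ] with ω hconc
  refine ⟨?_, ?_⟩
  · filter_upwards [hconc, hMB, hL1, hn3, hnB, hDhalf] with n h hMn hL hn hB hDn
    exact h.degree_pos ha hB0 hMn hB hn hL (hD ▸ hDn)
  · have hshare := fun k => tendsto_classShare hc hm hconc hτ k
    have hsum : Tendsto (fun n => ∑ k, |classShare (g n) (fun i => q n i ω) k - c k|) atTop
        (𝓝 0) := by
      have h := tendsto_finsetSum Finset.univ fun k _ => ((hshare k).sub_const (c k)).abs
      simpa using h
    refine squeeze_zero' (Eventually.of_forall fun n => opNorm_nonneg _) ?_ (g := fun n : ℕ =>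
      4 * (1 + a ^ (-α)) ^ 2 * C *
        √(10 * (√(8 * Real.log n) ^ 2 * ((√(n : ℝ))⁻¹ * √(8 * Real.log n)))) +
      (1 + a ^ (-α)) ^ 2 *
        (24 * C * D * (√(8 * Real.log n) * ((√(n : ℝ))⁻¹ * √(8 * Real.log n))) +
        8 * D ^ 2 * (√(8 * Real.log n) * ((√(n : ℝ))⁻¹ * √(8 * Real.log n))) +
        (4 * B * ∑ k, |classShare (g n) (fun i => q n i ω) k - c k| +
          5 / a ^ 2 * ((√(n : ℝ))⁻¹ * √(8 * Real.log n))))) ?_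
    · filter_upwards [hconc, hMB, hL1, hn3, hnB, hDhalf, hCone, hDη, hG]
        with n h hMn hL hn hB hDn hCn hDn' hGn
      refine h.opNorm_modularity_sub_spikedModel_le hGn.symm ha hB0 hMn hB hn hL hcsum hC0 hD rfl
        hDn hCn (fun i => abs_rpow_le_one_add_rpow ha (h.weight_mem i) _) fun x y hx hy => ?_
      rw [hC, mul_assoc]
      exact hpow _ hDn' x y hx hy
    · have h1 := ((hL2τ.const_mul 10).sqrt).const_mul (4 * (1 + a ^ (-α)) ^ 2 * C)
      have h2 := (((hLτ.const_mul (24 * C * D)).add (hLτ.const_mul (8 * D ^ 2))).add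
        ((hsum.const_mul (4 * B)).add (hτ.const_mul (5 / a ^ 2)))).const_mul
          ((1 + a ^ (-α)) ^ 2)
      simpa using h1.add h2
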